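/- **Setting.** Let $n,d,p\ge 1$ be integers, $L_1,L_2,\mu,\eta>0$, $c\ge b>0$, $l=\lceil\eta\rceil-1$ and $\sigma=L_1/\mu$. Let $f:[0,1]^d\times\mathbb R^p\to\mathbb R$, $f(x;\theta)$, be a loss function such that (i) for every $x\in[0,1]^d$ the gradient $\nabla_\theta f(x;\cdot)$ exists on $\mathbb R^p$ and is $L_1$-Lipschitz in the $\ell^2$-norm; (ii) for every $\vartheta\in\mathbb R^p$ and $i\le p$ the function $g_i=\frac{\partial f}{\partial\theta_i}(\cdot\,;\vartheta):[0,1]^d\to\mathbb R$ belongs to the $(\eta,L_2)$-Hölder class, i.e. it is $l$ times differentiable and $|\nabla^s g_i(y_1)-\nabla^s g_i(y_2)|\le L_2\|y_1-y_2\|_1^{\eta-l}$ for all $y_1,y_2\in[0,1]^d$ and all multi-indices $s$ with $|s|=l$; (iii) $f(x;\theta_1)\ge f(x;\theta_2)+\nabla_\theta f(x;\theta_2)^{\mathrm T}(\theta_1-\theta_2)+\frac\mu2\|\theta_1-\theta_2\|_2^2$ for all $x\in[0,1]^d$ and $\theta_1,\theta_2\in\mathbb R^p$. Put $$\Lambda(d,l)=\left(\frac{\pi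 d}{8e^2}\right)^{d\left(\frac{l+d}{d}\right)^d}\left(\left(\frac{l+d}{d}\right)^d-1\right)^{\left(\frac{l+d}{d}\right)^d-1}\frac{1}{(l+d)^{3l\left(\frac{e(l+d)}{d}\right)^d}},\qquad h'=\frac{2b}{55(2L_2+1)c}\cdot\frac{\Lambda(d,l)\,l}{d}.$$ Let $x^{(1)},\dots,x^{(n)}\in[h',1-h']^d$ be the training data, $F(\theta)=\frac1n\sum_{i=1}^n f(x^{(i)};\theta)$ and $F_*=\inf_\theta F(\theta)$. A vector $\theta$ is an $\epsilon$-approximate solution if $F(\theta)-F_*\le\epsilon$. Let $K:\mathbb R\to\mathbb R$ have values in $[b,c]$ on $[-1,1]$ and vanish outside $[-1,1]$. **Algorithm (LPI-GD).** Given $\epsilon>0$ and an arbitrary $\theta^{(0)}\in\mathbb R^p$, let $$T=\left\lceil\frac{\log\left(\frac{F(\theta^{(0)})-F_*+p/(2\mu)}{\epsilon}\right)}{\log\frac{\sigma}{\sigma-1}}\right\rceil,\quad \delta=\left(1-\tfrac1\sigma\right)^{T/2},\quad m=\left\lceil\frac{110(2L_2+1)c}{b}\cdot\frac{d(3e)^d}{\Lambda(d,l)^2}\,\delta^{-1/\eta}\right\rceil,\quad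 h=\frac{4l(3e)^d}{m\Lambda(d,l)},$$ and let $\mathcal G_m=\{1/m,2/m,\dots,1\}^d$. With $U(u)=[u^s/s!]_{s\in\mathbb Z_+^d,\,|s|\le l}$ and $$B(x)=\frac1{(mh)^d}\sum_{y\in\mathcal G_m}U\left(\tfrac{y-x}h\right)U\left(\tfrac{y-x}h\right)^{\mathrm T}\prod_{j=1}^dK\left(\tfrac{y_j-x_j}h\right),$$ let $w_y^*(x)$ be the entry with index $s=0$ of $\frac1{(mh)^d}\left(\prod_{j=1}^d K\left(\tfrac{y_j-x_j}h\right)\right)B(x)^{-1}U\left(\tfrac{y-x}h\right)$. For $t=1,\dots,T$, call the first-order oracle $(y,\vartheta)\mapsto\nabla_\theta f(y;\vartheta)$ at $(y,\theta^{(t-1)})$ for every $y\in\mathcal G_m$, and put $$\theta^{(t)}=\theta^{(t-1)}-\frac1{L_1}\cdot\frac1n\sum_{j=1}^n\sum_{y\in\mathcal G_m}w_y^*(x^{(j)})\,\nabla_\theta f(y;\theta^{(t-1)}).$$ Return $\theta^{(T)}$. The first-order oracle complexity $\Gamma$ of the algorithm is the minimum number of oracle calls that it makes to obtain an $\epsilon$-approximate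 solution. **Theorem.** Suppose that $l\ge d\ge19$ and $0<\epsilon\le\frac{(L_1-\mu)p}{2L_1\mu}$. Then the returned vector $\theta^{(T)}$ is an $\epsilon$-approximate solution, and both the total number of oracle calls of the run and the first-order oracle complexity $\Gamma$ of LPI-GD are at most $$C_{\mu,L_1,L_2,b,c}(d,l)\left(\frac{p+2\mu(F(\theta^{(0)})-F_*)}{\epsilon}\right)^{d/(2\eta)}\log\left(\frac{p+2\mu(F(\theta^{(0)})-F_*)}{2\mu\epsilon}\right),$$ where $$C_{\mu,L_1,L_2,b,c}(d,l)=\frac{\sigma+2(L_1-\mu)}{(L_1-\mu)\log\left(\frac{\sigma}{\sigma-1}\right)}\left(\frac{220(2L_2+1)c}{b}\right)^d\frac{d^d(3e)^{d^2}}{\Lambda(d,l)^{2d}}.$$ -/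

import Mathlib

noncomputable section

namespace LPIGD

/-! ### Deterministic algorithms with access to an oracle -/

/-- A deterministic algorithm that may call an oracle with queries in `Q` and answers in `A`, and
that looks for a solution in `S`.  It either stops with a solution, or reports its current
approximate solution and goes on, or makes one oracle call and goes on depending on the answer. -/
inductive OracleAlg (Q A S : Type) : Type
  | done (s : S) : OracleAlg Q A S
  | report (s : S) (next : OracleAlg Q A S) : OracleAlg Q A S
  | query (q : Q) (next : A → OracleAlg Q A S) : OracleAlg Q A S

namespace OracleAlg

variable {Q A S Y : Type}

/-- The solution with which the algorithm stops when the oracle is `O`. -/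
def output (O : Q → A) : OracleAlg Q A S → S
  | done s => s
  | report _ a => output O a
  | query q k => output O (k (O q))

/-- The total number of oracle calls made when the oracle is `O`. -/
def calls (O : Q → A) : OracleAlg Q A S → ℕ
  | done _ => 0
  | report _ a => calls O a
  | query q k => calls O (k (O q)) + 1

/-- All approximate solutions that the algorithm produces (those reported on the way and the
final one), each paired with the number of oracle calls made up to that moment, where `N` calls
have been made before. -/
def candidates (O : Q → A) : OracleAlg Q A S → ℕ → List (ℕ × S)
  | done s, N => [(N, s)]
  | report s a, N => (N, s) :: candidates O a N
  | query q k, N => candidates O (k (O q)) (N + 1)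

/-- Oracle complexity: the minimum number of oracle calls after which the algorithm has obtained
a solution that is `good` (it is `⊤` if the algorithm never obtains one). -/
def oracleComplexity (O : Q → A) (good : S → Prop) (a : OracleAlg Q A S) : ℕ∞ :=
  sInf {N : ℕ∞ | ∃ (k : ℕ) (s : S), (k, s) ∈ candidates O a 0 ∧ good s ∧ N = (k : ℕ∞)}

open Classical in
/-- Make the oracle calls `ask y` for the `y` in a list, one after the other, record the answers
in the table `ans`, and continue with the resulting table. -/
def queryAll (ask : Y → Q) : List Y → (Y → A) → ((Y → A) → OracleAlg Q A S) → OracleAlg Q A S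
  | [], ans, k => k ans
  | y :: ys, ans, k => query (ask y) (fun a => queryAll ask ys (Function.update ans y a) k)

end OracleAlg

/-! ### The problem class -/

/-- The data domain `[0,1]^d`. -/
def cube (d : ℕ) : Set (Fin d → ℝ) := Set.Icc 0 1

/-- The `(η, L)`-Hölder class on `[0,1]^d`: with `l = ⌈η⌉ - 1`, the function is `l` times
differentiable on the cube, and each of its partial derivatives
`∂^l g / ∂x_{j 0} ⋯ ∂x_{j (l-1)}` of order `l` is Hölder continuous with exponent `η - l` and
constant `L` for the `ℓ¹`-norm. -/
def HolderClass {d : ℕ} (η L : ℝ) (g : (Fin d → ℝ) → ℝ) : Prop :=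
  (∀ k : ℕ, k < ⌈η⌉₊ - 1 →
    DifferentiableOn ℝ (iteratedFDerivWithin ℝ k g (cube d)) (cube d)) ∧
  ∀ j : Fin (⌈η⌉₊ - 1) → Fin d, ∀ y₁ ∈ cube d, ∀ y₂ ∈ cube d,
    |iteratedFDerivWithin ℝ (⌈η⌉₊ - 1) g (cube d) y₁ (fun k => Pi.single (j k) 1) -
        iteratedFDerivWithin ℝ (⌈η⌉₊ - 1) g (cube d) y₂ (fun k => Pi.single (j k) 1)|
      ≤ L * (∑ i, |y₁ i - y₂ i|) ^ (η - ((⌈η⌉₊ - 1 : ℕ) : ℝ))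

/-- The assumptions on the loss function `f(x; θ)`, `x ∈ [0,1]^d`, `θ ∈ ℝ^p` (values of `f` for
`x` outside the cube are irrelevant). -/
structure LossAssumptions {d p : ℕ} (f : (Fin d → ℝ) → EuclideanSpace ℝ (Fin p) → ℝ)
    (L₁ η L₂ μ : ℝ) : Prop where
  L₁_pos : 0 < L₁
  η_pos : 0 < η
  L₂_pos : 0 < L₂
  μ_pos : 0 < μ
  /-- the gradient in the parameter exists -/
  differentiable : ∀ x ∈ cube d, Differentiable ℝ (f x)
  /-- the gradient in the parameter is `L₁`-Lipschitz in the parameter -/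
  lipschitz : ∀ x ∈ cube d, ∀ θ₁ θ₂,
    ‖gradient (f x) θ₁ - gradient (f x) θ₂‖ ≤ L₁ * ‖θ₁ - θ₂‖
  /-- each partial derivative in the parameter is in the Hölder class in the data -/
  holder : ∀ (ϑ : EuclideanSpace ℝ (Fin p)) (i : Fin p),
    HolderClass η L₂ (fun x => gradient (f x) ϑ i)
  /-- strong convexity in the parameter -/
  strongly_convex : ∀ x ∈ cube d, ∀ θ₁ θ₂,
    f x θ₂ + inner ℝ (gradient (f x) θ₂) (θ₁ - θ₂) + μ / 2 * ‖θ₁ - θ₂‖ ^ 2 ≤ f x θ₁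

/-- The first order oracle `(x, ϑ) ↦ ∇_θ f(x; ϑ)`. -/
def oracle {d p : ℕ} (f : (Fin d → ℝ) → EuclideanSpace ℝ (Fin p) → ℝ) :
    (Fin d → ℝ) × EuclideanSpace ℝ (Fin p) → EuclideanSpace ℝ (Fin p) :=
  fun q => gradient (f q.1) q.2

/-- The empirical risk of the training data `x`. -/
def risk {n d p : ℕ} (f : (Fin d → ℝ) → EuclideanSpace ℝ (Fin p) → ℝ)
    (x : Fin n → Fin d → ℝ) (θ : EuclideanSpace ℝ (Fin p)) : ℝ :=
  1 / (n : ℝ) * ∑ i, f (x i) θ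

/-- The infimum `F_*` of the empirical risk. -/
def minRisk {n d p : ℕ} (f : (Fin d → ℝ) → EuclideanSpace ℝ (Fin p) → ℝ)
    (x : Fin n → Fin d → ℝ) : ℝ :=
  ⨅ θ, risk f x θ

/-- `ε`-approximate solutions of the empirical risk minimization problem. -/
def IsApproxSolution {n d p : ℕ} (f : (Fin d → ℝ) → EuclideanSpace ℝ (Fin p) → ℝ)
    (x : Fin n → Fin d → ℝ) (ε : ℝ) (θ : EuclideanSpace ℝ (Fin p)) : Prop :=
  risk f x θ - minRisk f x ≤ ε

/-! ### Local polynomial interpolation -/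

/-- A kernel with values in `[b, c]` on `[-1,1]`, extended by zero. -/
structure IsKernel (K : ℝ → ℝ) (b c : ℝ) : Prop where
  b_pos : 0 < b
  b_le_c : b ≤ c
  mem_Icc : ∀ t ∈ Set.Icc (-1 : ℝ) 1, K t ∈ Set.Icc b c
  eq_zero : ∀ t ∉ Set.Icc (-1 : ℝ) 1, K t = 0

/-- The grid of the `u ∈ [0,1]^d` with `m u_i ∈ {1, …, m}` for all `i`. -/
def grid (d m : ℕ) : Finset (Fin d → ℝ) :=
  Fintype.piFinset fun _ => (Finset.Icc 1 m).image fun k : ℕ => (k : ℝ) / (m : ℝ)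

/-- The multi-indices `s ∈ ℤ₊^d` with `|s| ≤ l`. -/
abbrev MultiIndex (d l : ℕ) : Type := {s : Fin d → Fin (l + 1) // ∑ i, (s i : ℕ) ≤ l}

/-- The multi-index zero. -/
def MultiIndex.zero (d l : ℕ) : MultiIndex d l := ⟨fun _ => 0, by simp⟩

/-- The vector `U(u)` of all `u^s / s!` with `|s| ≤ l`. -/
def monomials {d : ℕ} (l : ℕ) (u : Fin d → ℝ) : MultiIndex d l → ℝ :=
  fun s => (∏ i, u i ^ (s.1 i : ℕ)) / (∏ i, ((s.1 i : ℕ).factorial : ℝ))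

/-- The product kernel weight of the grid point `y` at `x` for the bandwidth `h`. -/
def kernelWeight {d : ℕ} (K : ℝ → ℝ) (h : ℝ) (x y : Fin d → ℝ) : ℝ :=
  ∏ j, K ((y j - x j) / h)

/-- The matrix `B(x)` of the weighted regression problem. -/
def regressionMatrix {d : ℕ} (l : ℕ) (K : ℝ → ℝ) (m : ℕ) (h : ℝ) (x : Fin d → ℝ) :
    Matrix (MultiIndex d l) (MultiIndex d l) ℝ :=
  (1 / ((m : ℝ) * h) ^ d) • ∑ y ∈ grid d m,
    kernelWeight K h x y •
      Matrix.vecMulVec (monomials l (fun j => (y j - x j) / h))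
        (monomials l (fun j => (y j - x j) / h))

/-- The interpolation weight `w*_y(x)`: the entry at the multi-index zero of
`(m h)^{-d} (∏_j K((y_j - x_j)/h)) B(x)^{-1} U((y - x)/h)`. -/
def interpolationWeight {d : ℕ} (l : ℕ) (K : ℝ → ℝ) (m : ℕ) (h : ℝ) (y x : Fin d → ℝ) : ℝ :=
  1 / ((m : ℝ) * h) ^ d * kernelWeight K h x y *
    ((regressionMatrix l K m h x)⁻¹.mulVec (monomials l (fun j => (y j - x j) / h)))
      (MultiIndex.zero d l)

/-! ### The algorithm -/

/-- The approximation of the gradient of the empirical risk, computed from the table `ans` of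
the gradients of the loss at the grid points: the local polynomial interpolators of the partial
derivatives are averaged over the training data `x`. -/
def gradientEstimate {n d p : ℕ} (l : ℕ) (K : ℝ → ℝ) (m : ℕ) (h : ℝ) (x : Fin n → Fin d → ℝ)
    (ans : (Fin d → ℝ) → EuclideanSpace ℝ (Fin p)) : EuclideanSpace ℝ (Fin p) :=
  WithLp.toLp 2 fun i =>
    1 / (n : ℝ) * ∑ j, ∑ y ∈ grid d m, ans y i * interpolationWeight l K m h y (x j)

/-- Local polynomial interpolation based gradient descent with training data `x`, run for the
given number of iterations from the given parameter vector.  Each iteration calls the oracle once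
at every grid point with the current parameter vector, and then makes an inexact gradient step of
size `1 / L₁`. -/
def lpiGD {n d p : ℕ} (l : ℕ) (K : ℝ → ℝ) (L₁ : ℝ) (m : ℕ) (h : ℝ) (x : Fin n → Fin d → ℝ) :
    ℕ → EuclideanSpace ℝ (Fin p) →
      OracleAlg ((Fin d → ℝ) × EuclideanSpace ℝ (Fin p)) (EuclideanSpace ℝ (Fin p))
        (EuclideanSpace ℝ (Fin p))
  | 0, θ => .done θ
  | T + 1, θ => .report θ <|
      OracleAlg.queryAll (fun y => (y, θ)) (grid d m).toList (fun _ => 0) fun ans =>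
        lpiGD l K L₁ m h x T (θ - (1 / L₁) • gradientEstimate l K m h x ans)

/-! ### The constants -/

/-- The constant `Λ(d, l)`. -/
def Lam (d l : ℕ) : ℝ :=
  (Real.pi * d / (8 * Real.exp 1 ^ 2)) ^ ((d : ℝ) * (((l : ℝ) + d) / d) ^ d) *
    ((((l : ℝ) + d) / d) ^ d - 1) ^ ((((l : ℝ) + d) / d) ^ d - 1) *
    (1 / ((l : ℝ) + d) ^ (3 * (l : ℝ) * (Real.exp 1 * ((l : ℝ) + d) / d) ^ d))

/-- The margin between the training data and the boundary of the cube. -/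
def margin (d l : ℕ) (L₂ b c : ℝ) : ℝ :=
  2 * b / (55 * (2 * L₂ + 1) * c) * (Lam d l * l / d)

/-- The constant `C_{μ,L₁,L₂,b,c}(d, l)`. -/
def complexityConst (μ L₁ L₂ b c : ℝ) (d l : ℕ) : ℝ :=
  (L₁ / μ + 2 * (L₁ - μ)) / ((L₁ - μ) * Real.log ((L₁ / μ) / (L₁ / μ - 1))) *
    (220 * (2 * L₂ + 1) * c / b) ^ d *
    ((d : ℝ) ^ d * (3 * Real.exp 1) ^ (d ^ 2) / Lam d l ^ (2 * d))

/-- The bound `C ((p + 2μ gap)/ε)^{d/(2η)} log((p + 2μ gap)/(2με))`, where `gap` is the initial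
suboptimality `F(θ⁽⁰⁾) - F_*`. -/
def complexityBound (μ L₁ L₂ b c η ε gap : ℝ) (d l p : ℕ) : ℝ :=
  complexityConst μ L₁ L₂ b c d l *
    (((p : ℝ) + 2 * μ * gap) / ε) ^ ((d : ℝ) / (2 * η)) *
    Real.log (((p : ℝ) + 2 * μ * gap) / (2 * μ * ε))

end LPIGD

end

open LPIGD

/-! The algorithm is gradient descent with an inexact gradient. Smoothness and the
Polyak–Łojasiewicz inequality (from strong convexity) make a step of size 1/L₁ contract F − F_* by
the factor 1 − μ/L₁, and an error of at most δ in each gradient coordinate adds at most pδ²/(2L₁)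
(`risk_step`). Summing the geometric series with δ² = (1 − 1/σ)^T bounds the final gap by (1 −
1/σ)^T (gap + p/(2μ)), and T is chosen to make this at most ε.

So the point is that the interpolation error is at most δ. The weights reproduce polynomials of
degree at most l, hence only the Taylor remainder is seen and the error is at most (∑|w|) · L₂
(dh)^η (`abs_sum_mul_interpolationWeight_sub_le`). The sum ∑|w| is bounded without estimating
eigenvalues of B(x): by Cauchy–Schwarz the weights are compared with tensor product Lagrange weights
on l + 1 nearby grid points per coordinate, which also reproduce polynomials and have explicit
bounds (`sq_sum_abs_interpolationWeight_le`). The resulting bound on (∑|w|)² is the d-th power of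
(c/b)(2mh + 1)(l + 1)^(2l+1). Since Λ ≤ (l + d)^(−5l) (`Lam_le`), the factor Λ in dh absorbs it
(`sum_abs_mul_holder_le_one`).

A run makes at most T m^d calls; inserting the roundings of T and m gives the stated bound
(`calls_le_complexityBound`). -/

namespace LPIGD

/-! ### Outputs and call counts of oracle programs. -/

namespace OracleAlg

variable {Q A S Y : Type}

open Classical in
theorem output_queryAll (O : Q → A) (ask : Y → Q) (ys : List Y) (ans : Y → A)
    (k : (Y → A) → OracleAlg Q A S) :
    (queryAll ask ys ans k).output O =
      (k fun y => if y ∈ ys then O (ask y) else ans y).output O := by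
  induction ys generalizing ans with
  | nil => simp [queryAll]
  | cons y ys ih =>
    rw [queryAll, output, ih]
    congr 2
    funext z
    by_cases hz : z ∈ ys
    · simp [hz]
    · by_cases hzy : z = y
      · subst hzy; simp [hz]
      · simp [hz, hzy]

open Classical in
theorem calls_queryAll (O : Q → A) (ask : Y → Q) (ys : List Y) (ans : Y → A)
    (k : (Y → A) → OracleAlg Q A S) :
    (queryAll ask ys ans k).calls O =
      (k fun y => if y ∈ ys then O (ask y) else ans y).calls O + ys.length := by
  induction ys generalizing ans with
  | nil => simp [queryAll]
  | cons y ys ih =>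
    rw [queryAll, calls, ih, List.length_cons, add_assoc]
    congr 3
    funext z
    by_cases hz : z ∈ ys
    · simp [hz]
    · by_cases hzy : z = y
      · subst hzy; simp [hz]
      · simp [hz, hzy]

theorem output_mem_candidates (O : Q → A) (a : OracleAlg Q A S) (N : ℕ) :
    (N + a.calls O, a.output O) ∈ a.candidates O N := by
  induction a generalizing N with
  | done s => simp [candidates, calls, output]
  | report s a ih =>
    simp only [candidates, calls, output]
    exact List.mem_cons_of_mem _ (ih N)
  | query q k ih =>
    simp only [candidates, calls, output]
    have := ih (O q) (N + 1)
    rwa [show N + 1 + (k (O q)).calls O = N + ((k (O q)).calls O + 1) by ring] at this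

/-- The final output is itself a candidate, listed with the total number of calls, so the infimum
defining the complexity is finite. -/
theorem exists_oracleComplexity_eq (O : Q → A) (good : S → Prop) (a : OracleAlg Q A S)
    (ha : good (a.output O)) :
    ∃ Γ : ℕ, a.oracleComplexity O good = (Γ : ℕ∞) ∧ Γ ≤ a.calls O := by
  have hle : a.oracleComplexity O good ≤ (a.calls O : ℕ∞) := by
    refine sInf_le ⟨a.calls O, a.output O, ?_, ha, rfl⟩
    simpa using output_mem_candidates O a 0
  obtain ⟨Γ, hΓ, hΓ'⟩ := ENat.le_natCast_iff.1 hle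
  exact ⟨Γ, hΓ, hΓ'⟩

end OracleAlg

/-! ### The algorithm as a gradient recursion. -/

section Run

variable {n d p : ℕ} (l : ℕ) (K : ℝ → ℝ) (L₁ : ℝ) (m : ℕ) (h : ℝ) (x : Fin n → Fin d → ℝ)

theorem gradientEstimate_congr {ans ans' : (Fin d → ℝ) → EuclideanSpace ℝ (Fin p)}
    (H : ∀ y ∈ grid d m, ans y = ans' y) :
    gradientEstimate l K m h x ans = gradientEstimate l K m h x ans' := by
  unfold gradientEstimate
  congr 1
  funext i
  congr 1
  refine Finset.sum_congr rfl fun j _ => Finset.sum_congr rfl fun y hy => ?_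
  rw [H y hy]

theorem output_lpiGD_succ (f : (Fin d → ℝ) → EuclideanSpace ℝ (Fin p) → ℝ) (T : ℕ)
    (θ : EuclideanSpace ℝ (Fin p)) :
    (lpiGD l K L₁ m h x (T + 1) θ).output (oracle f) =
      (lpiGD l K L₁ m h x T (θ - (1 / L₁) •
        gradientEstimate l K m h x fun y => gradient (f y) θ)).output (oracle f) := by
  rw [lpiGD, OracleAlg.output, OracleAlg.output_queryAll]
  congr 4
  refine gradientEstimate_congr l K m h x fun y hy => ?_
  simp [hy, oracle]

theorem calls_lpiGD (f : (Fin d → ℝ) → EuclideanSpace ℝ (Fin p) → ℝ) (T : ℕ)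
    (θ : EuclideanSpace ℝ (Fin p)) :
    (lpiGD l K L₁ m h x T θ).calls (oracle f) = T * (grid d m).card := by
  induction T generalizing θ with
  | zero => simp [lpiGD, OracleAlg.calls]
  | succ T ih =>
    rw [lpiGD, OracleAlg.calls, OracleAlg.calls_queryAll, ih, Finset.length_toList]
    ring

end Run

theorem card_grid_le (d m : ℕ) : (grid d m).card ≤ m ^ d := by
  rw [grid, Fintype.card_piFinset]
  calc _ ≤ ∏ _i : Fin d, m := Finset.prod_le_prod' fun _ _ =>
        Finset.card_image_le.trans (by simp)
    _ = m ^ d := by simp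

/-! ### The descent lemma for Lipschitz gradients. -/

section Descent

variable {E : Type*} [NormedAddCommGroup E] [InnerProductSpace ℝ E] [CompleteSpace E]

theorem le_quadratic_of_lipschitz_gradient {F : E → ℝ} {L : ℝ} (hF : Differentiable ℝ F)
    (hL : ∀ a b, ‖gradient F a - gradient F b‖ ≤ L * ‖a - b‖) (a v : E) :
    F (a + v) ≤ F a + inner ℝ (gradient F a) v + L / 2 * ‖v‖ ^ 2 := by
  -- The gap between F on the segment and its quadratic majorant. The Lipschitz bound makes its
  -- derivative nonpositive, so φ 1 ≤ φ 0 is the claim.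
  set φ : ℝ → ℝ := fun t => F (a + t • v) - t * inner ℝ (gradient F a) v - L / 2 * t ^ 2 * ‖v‖ ^ 2
  have hφ : ∀ t, HasDerivAt φ (inner ℝ (gradient F (a + t • v)) v - inner ℝ (gradient F a) v
      - L * t * ‖v‖ ^ 2) t := by
    intro t
    have h1 : HasDerivAt (fun t : ℝ => a + t • v) v t := by
      simpa using ((hasDerivAt_id t).smul_const v).const_add a
    have h2 := (hF (a + t • v)).hasGradientAt.hasFDerivAt.comp_hasDerivAt t h1
    rw [InnerProductSpace.toDual_apply_apply] at h2
    have h3 := (h2.sub ((hasDerivAt_id t).mul_const (inner ℝ (gradient F a) v))).sub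
      ((((hasDerivAt_id t).pow 2).const_mul (L / 2)).mul_const (‖v‖ ^ 2))
    refine h3.congr_deriv ?_
    simp only [id_eq, Nat.cast_ofNat, one_mul, mul_one]
    ring
  have hanti : AntitoneOn φ (Set.Icc 0 1) := by
    refine antitoneOn_of_deriv_nonpos (convex_Icc 0 1)
      (fun t _ => (hφ t).continuousAt.continuousWithinAt)
      (fun t _ => (hφ t).differentiableAt.differentiableWithinAt) fun t ht => ?_
    rw [interior_Icc] at ht
    rw [(hφ t).deriv, ← inner_sub_left]
    have h1 := real_inner_le_norm (gradient F (a + t • v) - gradient F a) v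
    have h2 := hL (a + t • v) a
    rw [add_sub_cancel_left, norm_smul, Real.norm_of_nonneg ht.1.le] at h2
    nlinarith [mul_le_mul_of_nonneg_right h2 (norm_nonneg v)]
  have := hanti (by simp) (by simp) zero_le_one
  simp only [φ, one_smul, zero_smul, add_zero, one_mul, zero_mul, sub_zero, one_pow, mul_one, ne_eq,
    OfNat.ofNat_ne_zero, not_false_eq_true, zero_pow, mul_zero] at this
  linarith

end Descent

/-! ### Convergence of inexact gradient descent. -/

section Risk

variable {n d p : ℕ} {f : (Fin d → ℝ) → EuclideanSpace ℝ (Fin p) → ℝ} {L₁ η L₂ μ : ℝ}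
  {x : Fin n → Fin d → ℝ}

/-- Polyak–Łojasiewicz: minimise the strongly convex lower bound over the distance to θ. It also
shows that the risk is bounded below, so that the real infimum is meaningful. -/
theorem risk_lower (hn : 1 ≤ n) (hf : LossAssumptions f L₁ η L₂ μ) (hx : ∀ i, x i ∈ cube d)
    (θ θ' : EuclideanSpace ℝ (Fin p)) :
    risk f x θ - ‖(1 / (n : ℝ)) • ∑ i, gradient (f (x i)) θ‖ ^ 2 / (2 * μ) ≤ risk f x θ' := by
  have hn' : (0 : ℝ) < n := by exact_mod_cast hn
  have hμ := hf.μ_pos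
  set g := (1 / (n : ℝ)) • ∑ i, gradient (f (x i)) θ with hg
  have h1 : risk f x θ + inner ℝ g (θ' - θ) + μ / 2 * ‖θ' - θ‖ ^ 2 ≤ risk f x θ' := by
    have := Finset.sum_le_sum fun i (_ : i ∈ Finset.univ) =>
      hf.strongly_convex (x i) (hx i) θ' θ
    rw [Finset.sum_add_distrib, Finset.sum_add_distrib, Finset.sum_const, Finset.card_univ,
      Fintype.card_fin, nsmul_eq_mul, ← sum_inner] at this
    have := mul_le_mul_of_nonneg_left this (one_div_pos.2 hn').le
    rw [hg, inner_smul_left]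
    simp only [risk, map_div₀, map_one, map_natCast] at this ⊢
    refine le_trans (le_of_eq ?_) this
    field_simp
  have h2 := neg_le_of_abs_le (abs_real_inner_le_norm g (θ' - θ))
  have h3 : ‖g‖ ^ 2 / (2 * μ) - ‖g‖ * ‖θ' - θ‖ + μ / 2 * ‖θ' - θ‖ ^ 2 =
      (‖g‖ - μ * ‖θ' - θ‖) ^ 2 / (2 * μ) := by field_simp; ring
  have h4 : 0 ≤ (‖g‖ - μ * ‖θ' - θ‖) ^ 2 / (2 * μ) := by positivity
  linarith

theorem minRisk_le (hn : 1 ≤ n) (hf : LossAssumptions f L₁ η L₂ μ) (hx : ∀ i, x i ∈ cube d)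
    (θ : EuclideanSpace ℝ (Fin p)) : minRisk f x ≤ risk f x θ :=
  ciInf_le ⟨_, by rintro _ ⟨θ', rfl⟩; exact risk_lower hn hf hx 0 θ'⟩ θ

/-- With step size exactly 1/L₁ the square completes: the descent lemma yields (‖v − g‖² −
‖g‖²)/(2L₁) with no cross term, and Polyak–Łojasiewicz turns −‖g‖² into the contraction. -/
theorem risk_step (hn : 1 ≤ n) (hf : LossAssumptions f L₁ η L₂ μ) (hx : ∀ i, x i ∈ cube d)
    (θ v : EuclideanSpace ℝ (Fin p)) :
    risk f x (θ - (1 / L₁) • v) - minRisk f x ≤ (1 - μ / L₁) * (risk f x θ - minRisk f x) +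
      ‖v - (1 / (n : ℝ)) • ∑ i, gradient (f (x i)) θ‖ ^ 2 / (2 * L₁) := by
  have hn' : (0 : ℝ) < n := by exact_mod_cast hn
  have hμ := hf.μ_pos
  have hL := hf.L₁_pos
  set g := (1 / (n : ℝ)) • ∑ i, gradient (f (x i)) θ with hg
  have h1 : risk f x (θ - (1 / L₁) • v) ≤
      risk f x θ + inner ℝ g (-((1 / L₁) • v)) + L₁ / 2 * ‖-((1 / L₁) • v)‖ ^ 2 := by
    have := Finset.sum_le_sum fun i (_ : i ∈ Finset.univ) =>
      le_quadratic_of_lipschitz_gradient (hf.differentiable (x i) (hx i))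
        (hf.lipschitz (x i) (hx i)) θ (-((1 / L₁) • v))
    rw [Finset.sum_add_distrib, Finset.sum_add_distrib, Finset.sum_const, Finset.card_univ,
      Fintype.card_fin, nsmul_eq_mul, ← sum_inner] at this
    have := mul_le_mul_of_nonneg_left this (one_div_pos.2 hn').le
    rw [hg, inner_smul_left, sub_eq_add_neg]
    simp only [risk, map_div₀, map_one, map_natCast] at this ⊢
    refine this.trans (le_of_eq ?_)
    field_simp
  have h2 : risk f x θ - ‖g‖ ^ 2 / (2 * μ) ≤ minRisk f x :=
    le_ciInf fun θ' => risk_lower hn hf hx θ θ'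
  have h3 : inner ℝ g (-((1 / L₁) • v)) + L₁ / 2 * ‖-((1 / L₁) • v)‖ ^ 2 =
      (‖v - g‖ ^ 2 - ‖g‖ ^ 2) / (2 * L₁) := by
    rw [norm_neg, norm_smul, inner_neg_right, inner_smul_right, norm_sub_sq_real,
      Real.norm_of_nonneg (one_div_pos.2 hL).le, real_inner_comm]
    field_simp
    ring
  have h4 : μ / L₁ * (risk f x θ - minRisk f x) ≤ ‖g‖ ^ 2 / (2 * L₁) := by
    calc _ ≤ μ / L₁ * (‖g‖ ^ 2 / (2 * μ)) := by gcongr; linarith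
      _ = _ := by field_simp
  have h5 : (‖v - g‖ ^ 2 - ‖g‖ ^ 2) / (2 * L₁) = ‖v - g‖ ^ 2 / (2 * L₁) - ‖g‖ ^ 2 / (2 * L₁) := by
    ring
  linarith

theorem risk_output_lpiGD_le (hn : 1 ≤ n) (hf : LossAssumptions f L₁ η L₂ μ)
    (hx : ∀ i, x i ∈ cube d) (hμL : μ ≤ L₁) {l m : ℕ} {K : ℝ → ℝ} {h δ : ℝ}
    (H : ∀ (θ : EuclideanSpace ℝ (Fin p)) (i : Fin p) (j : Fin n),
      |∑ y ∈ grid d m, gradient (f y) θ i * interpolationWeight l K m h y (x j) -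
        gradient (f (x j)) θ i| ≤ δ) (T : ℕ) (θ : EuclideanSpace ℝ (Fin p)) :
    risk f x ((lpiGD l K L₁ m h x T θ).output (oracle f)) - minRisk f x ≤
      (1 - μ / L₁) ^ T * (risk f x θ - minRisk f x) +
        p * δ ^ 2 / (2 * μ) * (1 - (1 - μ / L₁) ^ T) := by
  have hn' : (0 : ℝ) < n := by exact_mod_cast hn
  have hμ := hf.μ_pos
  have hL := hf.L₁_pos
  have hr : 0 ≤ 1 - μ / L₁ := by rw [sub_nonneg, div_le_one hL]; exact hμL
  induction T generalizing θ with
  | zero => simp [lpiGD, OracleAlg.output]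
  | succ T ih =>
    rw [output_lpiGD_succ]
    set v : EuclideanSpace ℝ (Fin p) := gradientEstimate l K m h x fun y => gradient (f y) θ with hv
    have hstep := risk_step hn hf hx θ v
    have herr : ‖v - (1 / (n : ℝ)) • ∑ i, gradient (f (x i)) θ‖ ^ 2 ≤ p * δ ^ 2 := by
      rw [EuclideanSpace.norm_sq_eq]
      calc _ ≤ ∑ _i : Fin p, δ ^ 2 := Finset.sum_le_sum fun i _ => by
            gcongr
            have : (v - (1 / (n : ℝ)) • ∑ i, gradient (f (x i)) θ) i = 1 / (n : ℝ) *
                ∑ j, (∑ y ∈ grid d m, gradient (f y) θ i * interpolationWeight l K m h y (x j) -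
                  gradient (f (x j)) θ i) := by
              simp [hv, gradientEstimate, mul_sub]
            rw [this, Real.norm_eq_abs, abs_mul, abs_of_pos (one_div_pos.2 hn')]
            calc _ ≤ 1 / (n : ℝ) * ∑ _j : Fin n, δ := by
                  gcongr
                  exact (Finset.abs_sum_le_sum_abs _ _).trans
                    (Finset.sum_le_sum fun j _ => H θ i j)
              _ = δ := by simp; field_simp
        _ = p * δ ^ 2 := by simp
    refine (ih _).trans ?_
    have h1 : risk f x (θ - (1 / L₁) • v) - minRisk f x ≤
        (1 - μ / L₁) * (risk f x θ - minRisk f x) + p * δ ^ 2 / (2 * L₁) :=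
      hstep.trans (by gcongr)
    have h2 := mul_le_mul_of_nonneg_left h1 (pow_nonneg hr T)
    refine (add_le_add_left h2 _).trans (le_of_eq ?_)
    -- p δ²/(2μ) is the fixed point of the error recursion, which is why it multiplies 1 − r^T in
    -- the closed form, r = 1 − μ/L₁.
    have hE : p * δ ^ 2 / (2 * L₁) = μ / L₁ * (p * δ ^ 2 / (2 * μ)) := by field_simp
    rw [hE]
    ring

end Risk

/-! ### Polynomial reproduction and the size of the interpolation weights. -/

section Weights

variable {d l m : ℕ} {K : ℝ → ℝ} {b c h : ℝ} {x : Fin d → ℝ}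

theorem IsKernel.nonneg (hK : IsKernel K b c) (t : ℝ) : 0 ≤ K t := by
  by_cases ht : t ∈ Set.Icc (-1 : ℝ) 1
  · exact hK.b_pos.le.trans (hK.mem_Icc t ht).1
  · rw [hK.eq_zero t ht]

theorem kernelWeight_nonneg (hK : IsKernel K b c) (y : Fin d → ℝ) :
    0 ≤ kernelWeight K h x y :=
  Finset.prod_nonneg fun _ _ => hK.nonneg _

theorem div_mem_Icc_of_abs_le (hh : 0 < h) {s : ℝ} (hs : |s| ≤ h) :
    s / h ∈ Set.Icc (-1 : ℝ) 1 := by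
  rw [Set.mem_Icc, ← abs_le, abs_div, abs_of_pos hh]
  exact (div_le_one hh).2 hs

theorem pow_le_kernelWeight (hK : IsKernel K b c) (hh : 0 < h) {y : Fin d → ℝ}
    (hy : ∀ j, |y j - x j| ≤ h) : b ^ d ≤ kernelWeight K h x y := by
  calc b ^ d = ∏ _j : Fin d, b := by simp
    _ ≤ _ := Finset.prod_le_prod (fun _ _ => hK.b_pos.le) fun j _ =>
      (hK.mem_Icc _ (div_mem_Icc_of_abs_le hh (hy j))).1

theorem abs_sub_le_of_kernel_ne_zero (hK : IsKernel K b c) (hh : 0 < h) {s : ℝ}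
    (hs : K (s / h) ≠ 0) : |s| ≤ h := by
  by_contra hlt
  refine hs (hK.eq_zero _ fun hmem => hlt ?_)
  rwa [Set.mem_Icc, ← abs_le, abs_div, abs_of_pos hh, div_le_one hh] at hmem

theorem abs_sub_le_of_kernelWeight_ne_zero (hK : IsKernel K b c) (hh : 0 < h) {y : Fin d → ℝ}
    (hy : kernelWeight K h x y ≠ 0) (j : Fin d) : |y j - x j| ≤ h :=
  abs_sub_le_of_kernel_ne_zero hK hh fun h0 => hy (Finset.prod_eq_zero (Finset.mem_univ j) h0)

/-- An interval of length 2mh contains at most 2mh + 1 integers. The count runs in ℤ because its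
left end may be negative. -/
theorem sum_kernel_le (hK : IsKernel K b c) (hh : 0 < h) (hm : 0 < m) (t : ℝ) :
    ∑ a ∈ (Finset.Icc 1 m).image (fun k : ℕ => (k : ℝ) / (m : ℝ)), K ((a - t) / h) ≤
      c * (2 * (m * h) + 1) := by
  have hm' : (0 : ℝ) < m := by exact_mod_cast hm
  have hc : 0 < c := hK.b_pos.trans_le hK.b_le_c
  rw [Finset.sum_image fun a _ b _ hab => by
    have : (a : ℝ) = b := by field_simp at hab; exact hab
    exact_mod_cast this]
  set S := (Finset.Icc 1 m).filter fun k : ℕ => |(k : ℝ) / m - t| ≤ h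
  have hsum : ∑ k ∈ Finset.Icc 1 m, K (((k : ℝ) / m - t) / h) = ∑ k ∈ S, K (((k : ℝ) / m - t) / h) :=
    (Finset.sum_filter_of_ne fun k _ hk => abs_sub_le_of_kernel_ne_zero hK hh hk).symm
  have hmap : ∀ k ∈ S, (k : ℤ) ∈ Finset.Icc ⌈(m : ℝ) * t - m * h⌉ ⌊(m : ℝ) * t + m * h⌋ := by
    intro k hk
    obtain ⟨h1, h2⟩ := abs_le.1 (Finset.mem_filter.1 hk).2
    have h3 : (k : ℝ) = m * (k / m) := by field_simp
    rw [Finset.mem_Icc, Int.ceil_le, Int.le_floor]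
    push_cast
    constructor <;> rw [h3] <;> nlinarith
  have hcard : (S.card : ℝ) ≤ 2 * (m * h) + 1 := by
    have h1 := Finset.card_le_card_of_injOn (s := S) (fun k : ℕ => (k : ℤ)) hmap
      (fun a _ b _ hab => Int.ofNat.inj hab)
    rw [Int.card_Icc] at h1
    rcases le_or_gt (⌊(m : ℝ) * t + m * h⌋ + 1 - ⌈(m : ℝ) * t - m * h⌉) 0 with h0 | h0
    · rw [Int.toNat_of_nonpos h0] at h1
      have : S.card = 0 := by omega
      rw [this]; push_cast; positivity
    · have h2 : (S.card : ℤ) ≤ ⌊(m : ℝ) * t + m * h⌋ + 1 - ⌈(m : ℝ) * t - m * h⌉ := by omega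
      have h3 : (S.card : ℝ) ≤ ⌊(m : ℝ) * t + m * h⌋ + 1 - ⌈(m : ℝ) * t - m * h⌉ := by
        exact_mod_cast h2
      have h4 := Int.floor_le ((m : ℝ) * t + m * h)
      have h5 := Int.le_ceil ((m : ℝ) * t - m * h)
      linarith
  rw [hsum]
  calc _ ≤ ∑ _k ∈ S, c := Finset.sum_le_sum fun k hk =>
        (hK.mem_Icc _ (div_mem_Icc_of_abs_le hh (Finset.mem_filter.1 hk).2)).2
    _ = c * S.card := by rw [Finset.sum_const, nsmul_eq_mul, mul_comm]
    _ ≤ _ := by gcongr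

theorem sum_kernelWeight_le (hK : IsKernel K b c) (hh : 0 < h) (hm : 0 < m) :
    ∑ y ∈ grid d m, kernelWeight K h x y ≤ (c * (2 * (m * h) + 1)) ^ d := by
  unfold grid kernelWeight
  rw [← Finset.prod_univ_sum (fun _ : Fin d => (Finset.Icc 1 m).image fun k : ℕ => (k : ℝ) / (m : ℝ))
    fun j a => K ((a - x j) / h)]
  calc _ ≤ ∏ _j : Fin d, c * (2 * (m * h) + 1) :=
        Finset.prod_le_prod (fun j _ => Finset.sum_nonneg fun _ _ => hK.nonneg _)
          fun j _ => sum_kernel_le hK hh hm (x j)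
    _ = _ := by simp

/-- The weights of tensor product Lagrange interpolation at `x` with nodes `N j` in the `j`-th
coordinate. -/
noncomputable def lagrangeWeight (N : Fin d → Finset ℝ) (x y : Fin d → ℝ) : ℝ :=
  ∏ j, (Lagrange.basis (N j) id (y j)).eval (x j)

theorem sum_lagrange_basis_mul_eval (S : Finset ℝ) (t : ℝ) (q : Polynomial ℝ)
    (hq : q.degree < S.card) :
    ∑ a ∈ S, (Lagrange.basis S id a).eval t * q.eval a = q.eval t := by
  conv_rhs => rw [Lagrange.eq_interpolate (s := S) (v := id) Function.injective_id.injOn hq]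
  rw [Lagrange.interpolate_apply, Polynomial.eval_finsetSum]
  refine Finset.sum_congr rfl fun a _ => ?_
  rw [Polynomial.eval_mul, Polynomial.eval_C, mul_comm, id]

/-- The sum factors over coordinates. In each one, Lagrange interpolation on l + 1 nodes is exact in
degree at most l, so it returns the power centred at x evaluated at x itself. -/
theorem sum_lagrangeWeight_mul_monomials {N : Fin d → Finset ℝ} (hN : ∀ j, (N j).card = l + 1)
    (s : MultiIndex d l) :
    ∑ y ∈ Fintype.piFinset N, lagrangeWeight N x y * monomials l (fun j => (y j - x j) / h) s =
      if s = MultiIndex.zero d l then 1 else 0 := by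
  have h1 : ∀ y : Fin d → ℝ, lagrangeWeight N x y * monomials l (fun j => (y j - x j) / h) s =
      ∏ j, (Lagrange.basis (N j) id (y j)).eval (x j) *
        (((y j - x j) / h) ^ (s.1 j : ℕ) / ((s.1 j : ℕ).factorial : ℝ)) := by
    intro y
    rw [lagrangeWeight, monomials, Finset.prod_mul_distrib, Finset.prod_div_distrib]
  simp_rw [h1]
  rw [← Finset.prod_univ_sum N fun j a => (Lagrange.basis (N j) id a).eval (x j) *
        (((a - x j) / h) ^ (s.1 j : ℕ) / ((s.1 j : ℕ).factorial : ℝ))]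
  have h2 : ∀ j, ∑ a ∈ N j, (Lagrange.basis (N j) id a).eval (x j) *
        (((a - x j) / h) ^ (s.1 j : ℕ) / ((s.1 j : ℕ).factorial : ℝ)) =
        if s.1 j = 0 then 1 else 0 := by
    intro j
    set q : Polynomial ℝ := Polynomial.C (1 / (h ^ (s.1 j : ℕ) * ((s.1 j : ℕ).factorial : ℝ))) *
      (Polynomial.X - Polynomial.C (x j)) ^ (s.1 j : ℕ) with hq
    have hdeg : q.degree < (N j).card := by
      rw [hN j]
      rw [hq, ← Polynomial.smul_eq_C_mul]
      refine (Polynomial.degree_smul_le _ _).trans_lt ?_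
      rw [Polynomial.degree_pow, Polynomial.degree_X_sub_C, nsmul_one]
      exact_mod_cast (s.1 j).2
    have h3 := sum_lagrange_basis_mul_eval (N j) (x j) q hdeg
    have h4 : ∀ a, q.eval a = ((a - x j) / h) ^ (s.1 j : ℕ) / ((s.1 j : ℕ).factorial : ℝ) := by
      intro a
      simp only [hq, Polynomial.eval_mul, Polynomial.eval_C, Polynomial.eval_pow,
        Polynomial.eval_sub, Polynomial.eval_X, div_pow]
      rw [one_div, mul_comm, ← div_eq_mul_inv, div_div]
    simp_rw [h4] at h3
    rw [h3]
    by_cases h0 : s.1 j = 0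
    · simp [h0]
    · have : (s.1 j : ℕ) ≠ 0 := fun h' => h0 (Fin.ext h')
      simp [h0]
  simp_rw [h2]
  by_cases hs : s = MultiIndex.zero d l
  · subst hs; simp [MultiIndex.zero]
  · rw [if_neg hs]
    obtain ⟨j, hj⟩ : ∃ j, s.1 j ≠ 0 := by
      by_contra! hall
      exact hs (Subtype.ext (funext hall))
    exact Finset.prod_eq_zero (Finset.mem_univ j) (if_neg hj)

/-- A polynomial of degree at most l in each variable that vanishes on a product of sets of size l +
1 is zero; then compare coefficients. -/
theorem eq_zero_of_sum_monomials_eq_zero {S : Fin d → Finset ℝ} (hS : ∀ j, (S j).card = l + 1)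
    (a : MultiIndex d l → ℝ)
    (ha : ∀ u : Fin d → ℝ, (∀ j, u j ∈ S j) → ∑ s, a s * monomials l u s = 0) : a = 0 := by
  classical
  set e : MultiIndex d l → (Fin d →₀ ℕ) := fun s =>
    Finsupp.equivFunOnFinite.symm fun i => (s.1 i : ℕ) with he
  have hinj : Function.Injective e := by
    intro s s' hss
    refine Subtype.ext (funext fun i => Fin.ext ?_)
    simpa [he] using DFunLike.congr_fun hss i
  set P : MvPolynomial (Fin d) ℝ := ∑ s, MvPolynomial.monomial (e s)
    (a s / ∏ i, ((s.1 i : ℕ).factorial : ℝ)) with hP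
  have hP0 : P = 0 := by
    refine MvPolynomial.eq_zero_of_eval_zero_at_prod_finset P S (fun i => ?_) fun u hu => ?_
    · rw [hS i, Nat.lt_succ_iff, hP]
      refine (MvPolynomial.degreeOf_sum_le _ _ _).trans (Finset.sup_le fun s _ => ?_)
      rw [MvPolynomial.degreeOf_le_iff]
      intro t ht
      rw [Finset.mem_singleton.1 (MvPolynomial.support_monomial_subset ht)]
      simpa [he] using Nat.lt_succ_iff.1 (s.1 i).2
    · rw [← ha u hu, hP, map_sum]
      refine Finset.sum_congr rfl fun s _ => ?_
      rw [MvPolynomial.eval_monomial, Finsupp.prod_fintype _ _ (by simp), monomials]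
      simp only [he, Finsupp.coe_equivFunOnFinite_symm]
      ring
  funext s
  have hcoef := congrArg (MvPolynomial.coeff (e s)) hP0
  rw [hP, MvPolynomial.coeff_sum, Finset.sum_eq_single s] at hcoef
  · rw [MvPolynomial.coeff_monomial, if_pos rfl, MvPolynomial.coeff_zero, div_eq_zero_iff] at hcoef
    refine hcoef.resolve_right (Finset.prod_ne_zero_iff.2 fun i _ => ?_)
    exact_mod_cast Nat.factorial_ne_zero _
  · intro t _ hts
    rw [MvPolynomial.coeff_monomial, if_neg fun h' => hts (hinj h')]
  · simp

theorem regressionMatrix_mulVec (a : MultiIndex d l → ℝ) (s : MultiIndex d l) :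
    (regressionMatrix l K m h x).mulVec a s = 1 / ((m : ℝ) * h) ^ d * ∑ y ∈ grid d m,
      kernelWeight K h x y * monomials l (fun j => (y j - x j) / h) s *
        ∑ t, a t * monomials l (fun j => (y j - x j) / h) t := by
  rw [regressionMatrix, Matrix.smul_mulVec, Pi.smul_apply, smul_eq_mul, Matrix.sum_mulVec,
    Finset.sum_apply]
  congr 1
  refine Finset.sum_congr rfl fun y _ => ?_
  rw [Matrix.smul_mulVec, Matrix.vecMulVec_mulVec]
  simp [dotProduct, mul_comm, mul_assoc]

/-- The quadratic form of B is a sum of squares with kernel weights. These are at least b^d on the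
node grid, so a kernel vector of B gives a polynomial vanishing there. -/
theorem isUnit_det_regressionMatrix (hK : IsKernel K b c) (hh : 0 < h) (hm : 0 < m)
    {N : Fin d → Finset ℝ} (hN : ∀ j, (N j).card = l + 1)
    (hgrid : Fintype.piFinset N ⊆ grid d m) (hwin : ∀ j, ∀ a ∈ N j, |a - x j| ≤ h) :
    IsUnit (regressionMatrix l K m h x).det := by
  rw [isUnit_iff_ne_zero]
  intro hdet
  obtain ⟨a, ha0, ha⟩ := Matrix.exists_mulVec_eq_zero_iff.2 hdet
  refine ha0 ?_
  have hM : (0 : ℝ) < 1 / ((m : ℝ) * h) ^ d := by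
    have : (0 : ℝ) < m := by exact_mod_cast hm
    positivity
  have h1 : ∑ s, a s * (regressionMatrix l K m h x).mulVec a s = 0 := by simp [ha]
  have h2 : ∑ s, a s * (regressionMatrix l K m h x).mulVec a s = 1 / ((m : ℝ) * h) ^ d *
      ∑ y ∈ grid d m, kernelWeight K h x y *
        (∑ t, a t * monomials l (fun j => (y j - x j) / h) t) ^ 2 := by
    simp_rw [regressionMatrix_mulVec, Finset.mul_sum (s := grid d m)]
    rw [Finset.sum_comm]
    refine Finset.sum_congr rfl fun y _ => ?_
    rw [sq, Finset.sum_mul, Finset.mul_sum, Finset.mul_sum]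
    refine Finset.sum_congr rfl fun s _ => ?_
    ring
  rw [h2, mul_eq_zero, or_iff_right hM.ne', Finset.sum_eq_zero_iff_of_nonneg fun y _ =>
    mul_nonneg (kernelWeight_nonneg hK y) (sq_nonneg _)] at h1
  refine eq_zero_of_sum_monomials_eq_zero
    (S := fun j => (N j).image fun z => (z - x j) / h) (fun j => ?_) a fun u hu => ?_
  · rw [Finset.card_image_of_injective, hN j]
    intro z z' hz
    simpa [div_left_inj' hh.ne'] using hz
  · choose y hy hyu using fun j => Finset.mem_image.1 (hu j)
    have hu' : u = fun j => (y j - x j) / h := funext fun j => (hyu j).symm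
    have h3 := h1 y (hgrid (Fintype.mem_piFinset.2 hy))
    have h4 : 0 < kernelWeight K h x y :=
      (pow_pos hK.b_pos d).trans_le (pow_le_kernelWeight hK hh fun j => hwin j _ (hy j))
    rw [hu']
    exact pow_eq_zero_iff (two_ne_zero) |>.1 ((mul_eq_zero.1 h3).resolve_left h4.ne')

/-- The left side is an entry of the zero row of B⁻¹B. -/
theorem sum_interpolationWeight_mul_monomials
    (hB : IsUnit (regressionMatrix l K m h x).det) (s : MultiIndex d l) :
    ∑ y ∈ grid d m, interpolationWeight l K m h y x * monomials l (fun j => (y j - x j) / h) s =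
      if s = MultiIndex.zero d l then 1 else 0 := by
  set B := regressionMatrix l K m h x with hBdef
  have h1 : (B⁻¹ * B) (MultiIndex.zero d l) s = if s = MultiIndex.zero d l then 1 else 0 := by
    rw [Matrix.nonsing_inv_mul _ hB, Matrix.one_apply]
    simp only [eq_comm]
  rw [← h1, Matrix.mul_apply]
  simp_rw [interpolationWeight, ← hBdef, Matrix.mulVec, dotProduct]
  have h2 : ∀ t, B t s = ∑ y ∈ grid d m, 1 / ((m : ℝ) * h) ^ d * (kernelWeight K h x y *
      (monomials l (fun j => (y j - x j) / h) t * monomials l (fun j => (y j - x j) / h) s)) := by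
    intro t
    rw [hBdef, regressionMatrix, Matrix.smul_apply, Matrix.sum_apply, smul_eq_mul, Finset.mul_sum]
    rfl
  simp_rw [h2, Finset.mul_sum, Finset.sum_mul]
  rw [Finset.sum_comm]
  refine Finset.sum_congr rfl fun t _ => Finset.sum_congr rfl fun y _ => ?_
  ring

/-- Write w = κ·K·r with r the polynomial given by the zero row of B⁻¹. Every reproducing weight
system v satisfies ∑ v r = β, the zero diagonal entry of B⁻¹. Taking v = w gives κR = β; taking v
Lagrange and using K ≥ b^d on the nodes gives β² ≤ V R/b^d. Hence κβ ≤ V/b^d, and one more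
Cauchy–Schwarz bounds (∑|w|)² by κ²kR = kκβ. -/
theorem sq_sum_abs_interpolationWeight_le (hK : IsKernel K b c) (hh : 0 < h) (hm : 0 < m)
    {N : Fin d → Finset ℝ} (hN : ∀ j, (N j).card = l + 1)
    (hgrid : Fintype.piFinset N ⊆ grid d m) (hwin : ∀ j, ∀ a ∈ N j, |a - x j| ≤ h) :
    (∑ y ∈ grid d m, |interpolationWeight l K m h y x|) ^ 2 ≤
      (∑ y ∈ grid d m, kernelWeight K h x y) / b ^ d *
        ∑ y ∈ Fintype.piFinset N, lagrangeWeight N x y ^ 2 := by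
  have hB := isUnit_det_regressionMatrix hK hh hm hN hgrid hwin
  set B := regressionMatrix l K m h x with hBdef
  set r : (Fin d → ℝ) → ℝ := fun y =>
    ∑ s, B⁻¹ (MultiIndex.zero d l) s * monomials l (fun j => (y j - x j) / h) s with hr
  set κ : ℝ := 1 / ((m : ℝ) * h) ^ d with hκ
  have hκ0 : 0 < κ := by
    have : (0 : ℝ) < m := by exact_mod_cast hm
    positivity
  have hb : 0 < b ^ d := pow_pos hK.b_pos d
  set β := B⁻¹ (MultiIndex.zero d l) (MultiIndex.zero d l) with hβ
  have hw : ∀ y, interpolationWeight l K m h y x = κ * kernelWeight K h x y * r y := fun y => rfl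
  have hrep : ∀ (G : Finset (Fin d → ℝ)) (v : (Fin d → ℝ) → ℝ),
      (∀ s, ∑ y ∈ G, v y * monomials l (fun j => (y j - x j) / h) s =
        if s = MultiIndex.zero d l then 1 else 0) → ∑ y ∈ G, v y * r y = β := by
    intro G v hv
    simp_rw [hr, Finset.mul_sum]
    rw [Finset.sum_comm]
    calc _ = ∑ s, B⁻¹ (MultiIndex.zero d l) s *
          ∑ y ∈ G, v y * monomials l (fun j => (y j - x j) / h) s := by
          refine Finset.sum_congr rfl fun s _ => ?_
          rw [Finset.mul_sum]
          exact Finset.sum_congr rfl fun y _ => by ring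
      _ = β := by simp_rw [hv]; simp [hβ]
  have h1 : ∑ y ∈ grid d m, κ * (kernelWeight K h x y * r y ^ 2) = β := by
    rw [← hrep (grid d m) (fun y => interpolationWeight l K m h y x)
      (sum_interpolationWeight_mul_monomials hB)]
    exact Finset.sum_congr rfl fun y _ => by rw [hw]; ring
  rw [← Finset.mul_sum] at h1
  have h2 := hrep (Fintype.piFinset N) (lagrangeWeight N x) (sum_lagrangeWeight_mul_monomials hN)
  set V := ∑ y ∈ Fintype.piFinset N, lagrangeWeight N x y ^ 2 with hV
  set k := ∑ y ∈ grid d m, kernelWeight K h x y with hk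
  set R := ∑ y ∈ grid d m, kernelWeight K h x y * r y ^ 2 with hR
  have hR0 : 0 ≤ R := Finset.sum_nonneg fun y _ => mul_nonneg (kernelWeight_nonneg hK y) (sq_nonneg _)
  have hV0 : 0 ≤ V := Finset.sum_nonneg fun y _ => sq_nonneg _
  have hk0 : 0 ≤ k := Finset.sum_nonneg fun y _ => kernelWeight_nonneg hK y
  have h3 : b ^ d * ∑ y ∈ Fintype.piFinset N, r y ^ 2 ≤ R := by
    rw [Finset.mul_sum]
    refine (Finset.sum_le_sum fun y hy => ?_).trans
      (Finset.sum_le_sum_of_subset_of_nonneg hgrid fun y _ _ =>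
        mul_nonneg (kernelWeight_nonneg hK y) (sq_nonneg _))
    exact mul_le_mul_of_nonneg_right (pow_le_kernelWeight hK hh fun j =>
      hwin j _ (Fintype.mem_piFinset.1 hy j)) (sq_nonneg (r y))
  have h4 : β ^ 2 ≤ V * (R / b ^ d) := by
    rw [← h2]
    refine (Finset.sum_mul_sq_le_sq_mul_sq _ _ _).trans ?_
    gcongr
    rw [le_div_iff₀ hb]; linarith
  have h5 : κ * β ≤ V / b ^ d := by
    -- The factor R is to be cancelled, so R = 0, where β = 0, is separate.
    rcases hR0.eq_or_lt with h0 | h0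
    · rw [← h1, ← h0, mul_zero, mul_zero]; positivity
    · rw [← h1] at h4 ⊢
      have : κ * (κ * R) * R ≤ V / b ^ d * R := by
        calc _ = (κ * R) ^ 2 := by ring
          _ ≤ _ := h4
          _ = _ := by ring
      exact le_of_mul_le_mul_right this h0
  have h6 : (∑ y ∈ grid d m, |interpolationWeight l K m h y x|) ^ 2 ≤ κ ^ 2 * (k * R) := by
    have : ∀ y, |interpolationWeight l K m h y x| = κ * (kernelWeight K h x y * |r y|) := by
      intro y
      rw [hw, abs_mul, abs_mul, abs_of_pos hκ0, abs_of_nonneg (kernelWeight_nonneg hK y), mul_assoc]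
    simp_rw [this]
    rw [← Finset.mul_sum, mul_pow]
    gcongr
    refine Finset.sum_sq_le_sum_mul_sum_of_sq_le_mul _ (fun y _ => kernelWeight_nonneg hK y)
      (fun y _ => mul_nonneg (kernelWeight_nonneg hK y) (sq_nonneg _)) fun y _ => le_of_eq ?_
    rw [mul_pow, sq_abs]; ring
  calc _ ≤ κ ^ 2 * (k * R) := h6
    _ = k * (κ * β) := by rw [← h1]; ring
    _ ≤ k * (V / b ^ d) := by gcongr
    _ = _ := by ring

end Weights

/-! ### Lagrange nodes taken from the grid. -/

section Nodes

variable {d l m : ℕ} {h : ℝ} {x : Fin d → ℝ}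

theorem abs_lagrange_basis_eval_le {S : Finset ℝ} {δ R t : ℝ} (hδ : 0 < δ) (hδR : δ ≤ R)
    (hsep : ∀ a ∈ S, ∀ a' ∈ S, a ≠ a' → δ ≤ |a - a'|) (ht : ∀ a ∈ S, |t - a| ≤ R) {a : ℝ}
    (ha : a ∈ S) : |(Lagrange.basis S id a).eval t| ≤ (R / δ) ^ (S.card - 1) := by
  rw [Lagrange.basis, Polynomial.eval_prod, Finset.abs_prod]
  calc _ ≤ ∏ _a' ∈ S.erase a, R / δ := by
        refine Finset.prod_le_prod (fun _ _ => abs_nonneg _) fun a' ha' => ?_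
        rw [Finset.mem_erase] at ha'
        simp only [Lagrange.basisDivisor, id, Polynomial.eval_mul, Polynomial.eval_C,
          Polynomial.eval_sub, Polynomial.eval_X, abs_mul, abs_inv]
        rw [inv_mul_eq_div]
        exact div_le_div₀ (hδ.le.trans hδR) (ht a' ha'.2) hδ (hsep a ha a' ha'.2 ha'.1.symm)
    _ = _ := by rw [Finset.prod_const, Finset.card_erase_of_mem ha]

/-- The `l + 1` points of the grid of mesh `1 / m` that follow `t`. -/
noncomputable def nextNodes (l m : ℕ) (t : ℝ) : Finset ℝ :=
  (Finset.range (l + 1)).image fun i => ((⌊(m : ℝ) * t⌋₊ + 1 + i : ℕ) : ℝ) / m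

theorem natCast_div_injective (hm : 0 < m) (k : ℕ) :
    Function.Injective fun i : ℕ => ((k + i : ℕ) : ℝ) / m := by
  have hm' : (0 : ℝ) < m := by exact_mod_cast hm
  intro i i' hi
  have : ((k + i : ℕ) : ℝ) = (k + i' : ℕ) := by
    field_simp at hi
    exact hi
  exact Nat.add_left_cancel (by exact_mod_cast this)

theorem card_nextNodes (hm : 0 < m) (t : ℝ) : (nextNodes l m t).card = l + 1 := by
  rw [nextNodes, Finset.card_image_of_injective _ (natCast_div_injective hm _), Finset.card_range]

theorem abs_sub_le_of_mem_nextNodes (hm : 0 < m) {t a : ℝ} (ht : 0 ≤ t)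
    (ha : a ∈ nextNodes l m t) : |a - t| ≤ (l + 1) / m := by
  have hm' : (0 : ℝ) < m := by exact_mod_cast hm
  obtain ⟨i, hi, rfl⟩ := Finset.mem_image.1 ha
  have hi' : (i : ℝ) ≤ l := by exact_mod_cast Nat.lt_succ_iff.1 (Finset.mem_range.1 hi)
  have h1 := Nat.floor_le (mul_nonneg hm'.le ht)
  have h2 := Nat.lt_floor_add_one ((m : ℝ) * t)
  have h3 : ((⌊(m : ℝ) * t⌋₊ + 1 + i : ℕ) : ℝ) / m - t = (⌊(m : ℝ) * t⌋₊ + 1 + i - m * t) / m := by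
    push_cast; field_simp
  rw [h3, abs_div, abs_of_pos hm']
  gcongr
  rw [abs_le]
  constructor <;> linarith [Nat.cast_nonneg (α := ℝ) i]

/-- The nodes are 1/m apart and within (l + 1)/m of t, so each basis polynomial is at most (l + 1)^l
in absolute value at t; there are l + 1 of them. -/
theorem sum_sq_lagrange_nextNodes_le (hm : 0 < m) {t : ℝ} (ht : 0 ≤ t) :
    ∑ a ∈ nextNodes l m t, (Lagrange.basis (nextNodes l m t) id a).eval t ^ 2 ≤
      ((l : ℝ) + 1) ^ (2 * l + 1) := by
  have hm' : (0 : ℝ) < m := by exact_mod_cast hm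
  have hl : (0 : ℝ) ≤ l := Nat.cast_nonneg l
  calc _ ≤ ∑ _a ∈ nextNodes l m t, (((l : ℝ) + 1) ^ l) ^ 2 := by
        refine Finset.sum_le_sum fun a ha => ?_
        rw [← sq_abs]
        gcongr
        have h1 := abs_lagrange_basis_eval_le (S := nextNodes l m t) (δ := 1 / m)
          (R := (l + 1) / m) (t := t) (by positivity) (by gcongr; linarith) ?_ ?_ ha
        · rwa [card_nextNodes hm, Nat.add_sub_cancel, div_div_div_cancel_right₀ hm'.ne',
            div_one] at h1
        · intro a ha a' ha' hne
          obtain ⟨i, hi, rfl⟩ := Finset.mem_image.1 ha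
          obtain ⟨i', hi', rfl⟩ := Finset.mem_image.1 ha'
          have hii : (i : ℤ) - i' ≠ 0 := by
            intro h0
            exact hne (by rw [show i = i' by omega])
          have h2 : (1 : ℝ) ≤ |(i : ℝ) - i'| := by exact_mod_cast Int.one_le_abs hii
          rw [← sub_div, abs_div, abs_of_pos hm']
          gcongr
          push_cast
          rwa [add_sub_add_left_eq_sub]
        · intro a ha
          rw [abs_sub_comm]
          exact abs_sub_le_of_mem_nextNodes hm ht ha
    _ = _ := by
        rw [Finset.sum_const, card_nextNodes hm, nsmul_eq_mul]
        push_cast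
        ring

theorem sum_sq_lagrangeWeight_le (hm : 0 < m) (hx : ∀ j, 0 ≤ x j) :
    ∑ y ∈ Fintype.piFinset (fun j => nextNodes l m (x j)),
      lagrangeWeight (fun j => nextNodes l m (x j)) x y ^ 2 ≤
      (((l : ℝ) + 1) ^ (2 * l + 1)) ^ d := by
  simp_rw [lagrangeWeight, ← Finset.prod_pow]
  rw [← Finset.prod_univ_sum (fun j => nextNodes l m (x j)) fun j a =>
    (Lagrange.basis (nextNodes l m (x j)) id a).eval (x j) ^ 2]
  calc _ ≤ ∏ _j : Fin d, ((l : ℝ) + 1) ^ (2 * l + 1) :=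
        Finset.prod_le_prod (fun j _ => Finset.sum_nonneg fun _ _ => sq_nonneg _)
          fun j _ => sum_sq_lagrange_nextNodes_le hm (hx j)
    _ = _ := by simp

theorem piFinset_nextNodes_subset_grid (hm : 0 < m) (hx : ∀ j, 0 ≤ x j)
    (hx' : ∀ j, x j + (l + 1) / m ≤ 1) :
    Fintype.piFinset (fun j => nextNodes l m (x j)) ⊆ grid d m := by
  have hm' : (0 : ℝ) < m := by exact_mod_cast hm
  refine Fintype.piFinset_subset _ _ fun j a ha => ?_
  have h1 := (abs_le.1 (abs_sub_le_of_mem_nextNodes hm (hx j) ha)).2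
  obtain ⟨i, hi, rfl⟩ := Finset.mem_image.1 ha
  refine Finset.mem_image.2 ⟨_, Finset.mem_Icc.2 ⟨by omega, ?_⟩, rfl⟩
  have h2 : ((⌊(m : ℝ) * x j⌋₊ + 1 + i : ℕ) : ℝ) / m ≤ 1 := by linarith [hx' j]
  rw [div_le_one hm'] at h2
  exact_mod_cast h2

end Nodes

/-! ### Taylor expansion in the Hölder class. -/

section Taylor

variable {d : ℕ}

/-- Reduces the multivariate expansion on the cube to one variable, using only differentiability of
the derivatives of order below l. -/
theorem iteratedDerivWithin_segment {g : (Fin d → ℝ) → ℝ} {l : ℕ}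
    (hg : ∀ k < l, DifferentiableOn ℝ (iteratedFDerivWithin ℝ k g (cube d)) (cube d))
    {x y : Fin d → ℝ} (hx : x ∈ cube d) (hy : y ∈ cube d) :
    ∀ k ≤ l, ∀ t ∈ Set.Icc (0 : ℝ) 1,
      iteratedDerivWithin k (fun t : ℝ => g (x + t • (y - x))) (Set.Icc 0 1) t =
        iteratedFDerivWithin ℝ k g (cube d) (x + t • (y - x)) (fun _ => y - x) ∧
      (k < l → HasDerivWithinAt
        (fun t : ℝ => iteratedFDerivWithin ℝ k g (cube d) (x + t • (y - x)) (fun _ => y - x))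
        (iteratedFDerivWithin ℝ (k + 1) g (cube d) (x + t • (y - x)) (fun _ => y - x))
        (Set.Icc 0 1) t) := by
  have hmaps : Set.MapsTo (fun t : ℝ => x + t • (y - x)) (Set.Icc 0 1) (cube d) := fun t ht =>
    (convex_Icc (0 : Fin d → ℝ) 1).add_smul_sub_mem hx hy ht
  have hderiv : ∀ k < l, ∀ t ∈ Set.Icc (0 : ℝ) 1, HasDerivWithinAt
        (fun t : ℝ => iteratedFDerivWithin ℝ k g (cube d) (x + t • (y - x)) (fun _ => y - x))
        (iteratedFDerivWithin ℝ (k + 1) g (cube d) (x + t • (y - x)) (fun _ => y - x))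
        (Set.Icc 0 1) t := by
    intro k hk t ht
    have h1 : HasDerivWithinAt (fun t : ℝ => x + t • (y - x)) (y - x) (Set.Icc 0 1) t := by
      simpa using (((hasDerivAt_id t).smul_const (y - x)).const_add x).hasDerivWithinAt
    have h2 := ((hg k hk) _ (hmaps ht)).hasFDerivWithinAt.comp_hasDerivWithinAt t h1 hmaps
    have h3 := (ContinuousMultilinearMap.apply ℝ (fun _ : Fin k => (Fin d → ℝ)) ℝ
      (fun _ => y - x)).hasFDerivAt.comp_hasDerivWithinAt t h2
    exact h3
  intro k
  induction k with
  | zero =>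
    intro _ t ht
    exact ⟨by simp, fun hl => hderiv 0 hl t ht⟩
  | succ k ih =>
    intro hk t ht
    refine ⟨?_, fun hl => hderiv _ hl t ht⟩
    rw [iteratedDerivWithin_succ, derivWithin_congr (fun s hs => (ih (by omega) s hs).1)
      (ih (by omega) t ht).1]
    exact ((ih (by omega) t ht).2 hk).derivWithin (uniqueDiffOn_Icc zero_lt_one t ht)

theorem multilinear_apply_eq_sum {k : ℕ} (D : (Fin d → ℝ) [×k]→L[ℝ] ℝ) (v : Fin d → ℝ) :
    D (fun _ => v) = ∑ j : Fin k → Fin d, (∏ i, v (j i)) * D fun i => Pi.single (j i) 1 := by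
  have hv : v = ∑ a, v a • (Pi.single a 1 : Fin d → ℝ) := by
    simpa using pi_eq_sum_univ' v
  conv_lhs => rw [hv]
  rw [ContinuousMultilinearMap.map_sum]
  refine Finset.sum_congr rfl fun j _ => ?_
  rw [ContinuousMultilinearMap.map_smul_univ, smul_eq_mul]

theorem abs_sub_taylor_le {g : (Fin d → ℝ) → ℝ} {η L : ℝ} (hg : HolderClass η L g) (hL : 0 ≤ L)
    (hη : 1 < η) {x y : Fin d → ℝ} (hx : x ∈ cube d) (hy : y ∈ cube d) :
    |g y - ∑ k ∈ Finset.range (⌈η⌉₊ - 1 + 1), ((k.factorial : ℝ))⁻¹ *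
      iteratedFDerivWithin ℝ k g (cube d) x (fun _ => y - x)| ≤ L * (∑ i, |y i - x i|) ^ η := by
  obtain ⟨hdiff, hhol⟩ := hg
  have hl1 : 1 < ⌈η⌉₊ := by rw [Nat.lt_ceil]; exact_mod_cast hη
  have hlη : ((⌈η⌉₊ - 1 : ℕ) : ℝ) < η := by
    have := Nat.ceil_lt_add_one (zero_le_one.trans hη.le)
    rw [Nat.cast_sub hl1.le]; push_cast; linarith
  generalize hl : ⌈η⌉₊ - 1 = l at *
  obtain ⟨q, rfl⟩ : ∃ q, l = q + 1 := ⟨l - 1, by omega⟩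
  have hseg := iteratedDerivWithin_segment hdiff hx hy
  set φ : ℝ → ℝ := fun t : ℝ => g (x + t • (y - x)) with hφ
  have hdφ : ∀ k < q + 1, DifferentiableOn ℝ (iteratedDerivWithin k φ (Set.Icc 0 1))
      (Set.Icc 0 1) := fun k hk t ht =>
    (((hseg k hk.le t ht).2 hk).differentiableWithinAt).congr
      (fun s hs => (hseg k hk.le s hs).1) (hseg k hk.le t ht).1
  have hcont : ContDiffOn ℝ q φ (Set.Icc 0 1) :=
    contDiffOn_of_differentiableOn_deriv (n := (q : ℕ∞)) fun k hk =>
      hdφ k (Nat.lt_succ_of_le (by exact_mod_cast hk))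
  obtain ⟨ξ, hξ, hrem⟩ := taylor_mean_remainder_lagrange (f := φ) (x := 1) (x₀ := 0) (n := q)
    zero_ne_one (by rwa [Set.uIcc_of_le zero_le_one])
    (by
      rw [Set.uIcc_of_le zero_le_one, Set.uIoo_of_le zero_le_one]
      exact (hdφ q (Nat.lt_succ_self q)).mono Set.Ioo_subset_Icc_self)
  rw [Set.uIcc_of_le zero_le_one, taylor_within_apply] at hrem
  rw [Set.uIoo_of_le zero_le_one] at hξ
  have hξ' := Set.Ioo_subset_Icc_self hξ
  have h0 : (0 : ℝ) ∈ Set.Icc (0 : ℝ) 1 := by simp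
  rw [(hseg (q + 1) le_rfl ξ hξ').1] at hrem
  have hsum : ∑ k ∈ Finset.range (q + 1), ((k.factorial : ℝ)⁻¹ * ((1 : ℝ) - 0) ^ k) •
      iteratedDerivWithin k φ (Set.Icc 0 1) 0 = ∑ k ∈ Finset.range (q + 1),
      ((k.factorial : ℝ))⁻¹ * iteratedFDerivWithin ℝ k g (cube d) x (fun _ => y - x) := by
    refine Finset.sum_congr rfl fun k hk => ?_
    rw [(hseg k (Finset.mem_range.1 hk).le 0 h0).1]
    simp
  rw [hsum] at hrem
  rw [Finset.sum_range_succ]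
  set z := x + ξ • (y - x) with hz
  have hzc : z ∈ cube d := (convex_Icc (0 : Fin d → ℝ) 1).add_smul_sub_mem hx hy hξ'
  set s := ∑ i, |y i - x i| with hs
  have hs0 : 0 ≤ s := Finset.sum_nonneg fun _ _ => abs_nonneg _
  have hφ1 : φ 1 = g y := by simp [hφ]
  rw [hφ1] at hrem
  have heq : g y - (∑ k ∈ Finset.range (q + 1),
      ((k.factorial : ℝ))⁻¹ * iteratedFDerivWithin ℝ k g (cube d) x (fun _ => y - x) +
      (((q + 1).factorial : ℝ))⁻¹ * iteratedFDerivWithin ℝ (q + 1) g (cube d) x (fun _ => y - x)) =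
      (((q + 1).factorial : ℝ))⁻¹ *
        (iteratedFDerivWithin ℝ (q + 1) g (cube d) z (fun _ => y - x) -
          iteratedFDerivWithin ℝ (q + 1) g (cube d) x (fun _ => y - x)) := by
    rw [sub_add_eq_sub_sub, hrem]; simp; ring
  rw [heq, multilinear_apply_eq_sum, multilinear_apply_eq_sum, ← Finset.sum_sub_distrib, abs_mul]
  have hfac : |(((q + 1).factorial : ℝ))⁻¹| ≤ 1 := by
    rw [abs_of_nonneg (by positivity)]
    exact inv_le_one_of_one_le₀ (by exact_mod_cast Nat.succ_le_of_lt (Nat.factorial_pos _))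
  have hzx : ∑ i, |z i - x i| ≤ s := by
    refine Finset.sum_le_sum fun i _ => ?_
    simp only [hz, Pi.add_apply, Pi.smul_apply, Pi.sub_apply, smul_eq_mul, add_sub_cancel_left,
      abs_mul]
    rw [abs_of_nonneg hξ'.1]
    exact mul_le_of_le_one_left (abs_nonneg _) hξ'.2
  have hpow : ∑ j : Fin (q + 1) → Fin d, ∏ i, |y (j i) - x (j i)| = s ^ (q + 1) := by
    rw [hs]
    simpa using (Finset.prod_univ_sum (fun _ : Fin (q + 1) => (Finset.univ : Finset (Fin d)))
      (fun _ a => |y a - x a|)).symm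
  calc _ ≤ 1 * ∑ j : Fin (q + 1) → Fin d, (∏ i, |y (j i) - x (j i)|) *
        (L * s ^ (η - (q + 1 : ℕ))) := by
        refine mul_le_mul hfac ((Finset.abs_sum_le_sum_abs _ _).trans
          (Finset.sum_le_sum fun j _ => ?_)) (abs_nonneg _) zero_le_one
        rw [← mul_sub, abs_mul, Finset.abs_prod]
        simp only [Pi.sub_apply]
        gcongr
        refine (hhol j z hzc x hx).trans ?_
        gcongr
    _ = L * (s ^ ((q + 1 : ℕ) : ℝ) * s ^ (η - (q + 1 : ℕ))) := by
        rw [one_mul, ← Finset.sum_mul, hpow, Real.rpow_natCast]; ring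
    _ = L * s ^ η := by
        rw [← Real.rpow_add_of_nonneg hs0 (by positivity) (by linarith), add_sub_cancel]

end Taylor

/-! ### Error of local polynomial interpolation. -/

section InterpolationError

variable {d l m : ℕ} {K : ℝ → ℝ} {b c h : ℝ} {x : Fin d → ℝ}

theorem exists_multiIndex_prod_eq {k : ℕ} (hk : k ≤ l) (j : Fin k → Fin d) :
    ∃ s : MultiIndex d l, (s = MultiIndex.zero d l → k = 0) ∧
      ∃ C : ℝ, ∀ u : Fin d → ℝ, ∏ i, u (j i) = C * monomials l u s := by
  classical
  set e : Fin d → ℕ := fun a => (Finset.univ.filter fun i => j i = a).card with he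
  have hsum : ∑ a, e a = k := by
    simpa using (Finset.card_eq_sum_card_fiberwise (f := j) (s := Finset.univ)
      (t := Finset.univ) (fun _ _ => Finset.mem_coe.2 (Finset.mem_univ _))).symm
  have hle : ∀ a, e a ≤ l := fun a =>
    ((Finset.single_le_sum (fun _ _ => Nat.zero_le _) (Finset.mem_univ a)).trans hsum.le).trans hk
  refine ⟨⟨fun a => ⟨e a, Nat.lt_succ_of_le (hle a)⟩, by simpa [hsum] using hk⟩, fun h0 => ?_,
    ∏ a, ((e a).factorial : ℝ), fun u => ?_⟩
  · rw [← hsum]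
    refine Finset.sum_eq_zero fun a _ => ?_
    simpa [MultiIndex.zero] using congrArg Fin.val (congrFun (congrArg Subtype.val h0) a)
  · have hne : ∏ a, ((e a).factorial : ℝ) ≠ 0 :=
      Finset.prod_ne_zero_iff.2 fun a _ => by exact_mod_cast Nat.factorial_ne_zero _
    rw [monomials, mul_div_cancel₀ _ hne, ← Finset.prod_fiberwise Finset.univ j]
    refine Finset.prod_congr rfl fun a _ => ?_
    rw [Finset.prod_congr rfl fun i hi => by rw [(Finset.mem_filter.1 hi).2], Finset.prod_const]

theorem sum_interpolationWeight_mul_multilinear (hh : h ≠ 0)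
    (hB : IsUnit (regressionMatrix l K m h x).det) {k : ℕ} (hk : k ≤ l) (hk0 : k ≠ 0)
    (D : (Fin d → ℝ) [×k]→L[ℝ] ℝ) :
    ∑ y ∈ grid d m, interpolationWeight l K m h y x * D (fun _ => y - x) = 0 := by
  simp_rw [multilinear_apply_eq_sum, Finset.mul_sum]
  rw [Finset.sum_comm]
  refine Finset.sum_eq_zero fun j _ => ?_
  obtain ⟨s, hs0, C, hC⟩ := exists_multiIndex_prod_eq hk j
  have h1 : ∀ y : Fin d → ℝ, ∏ i, (y - x) (j i) =
      h ^ k * C * monomials l (fun j => (y j - x j) / h) s := by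
    intro y
    rw [mul_assoc, ← hC, Finset.prod_div_distrib, Finset.prod_const, Finset.card_univ,
      Fintype.card_fin, mul_div_cancel₀ _ (pow_ne_zero k hh)]
    rfl
  calc _ = (h ^ k * C * D fun i => Pi.single (j i) 1) * ∑ y ∈ grid d m,
        interpolationWeight l K m h y x * monomials l (fun j => (y j - x j) / h) s := by
        rw [Finset.mul_sum]
        exact Finset.sum_congr rfl fun y _ => by rw [h1]; ring
    _ = 0 := by
        rw [sum_interpolationWeight_mul_monomials hB, if_neg fun h' => hk0 (hs0 h'), mul_zero]

theorem grid_subset_cube {y : Fin d → ℝ} (hy : y ∈ grid d m) : y ∈ cube d := by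
  rw [grid, Fintype.mem_piFinset] at hy
  have : ∀ j, 0 ≤ y j ∧ y j ≤ 1 := by
    intro j
    obtain ⟨k, hk, hkj⟩ := Finset.mem_image.1 (hy j)
    rw [← hkj]
    exact ⟨by positivity, div_le_one_of_le₀ (by exact_mod_cast (Finset.mem_Icc.1 hk).2)
      (Nat.cast_nonneg m)⟩
  exact ⟨fun j => (this j).1, fun j => (this j).2⟩

theorem abs_sum_mul_interpolationWeight_sub_le (hK : IsKernel K b c) (hh : 0 < h)
    (hB : IsUnit (regressionMatrix l K m h x).det) {g : (Fin d → ℝ) → ℝ} {η L : ℝ}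
    (hg : HolderClass η L g) (hL : 0 ≤ L) (hη : 1 < η) (hl : ⌈η⌉₊ - 1 = l) (hx : x ∈ cube d) :
    |∑ y ∈ grid d m, g y * interpolationWeight l K m h y x - g x| ≤
      (∑ y ∈ grid d m, |interpolationWeight l K m h y x|) * (L * (d * h) ^ η) := by
  set P : (Fin d → ℝ) → ℝ := fun y => ∑ k ∈ Finset.range (l + 1), ((k.factorial : ℝ))⁻¹ *
      iteratedFDerivWithin ℝ k g (cube d) x (fun _ => y - x) with hP
  have hrep : ∑ y ∈ grid d m, interpolationWeight l K m h y x * P y = g x := by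
    simp_rw [hP, Finset.mul_sum]
    rw [Finset.sum_comm, Finset.sum_range_succ', Finset.sum_eq_zero, zero_add]
    · have h1 := sum_interpolationWeight_mul_monomials hB (MultiIndex.zero d l)
      rw [if_pos rfl] at h1
      have h2 : ∀ u : Fin d → ℝ, monomials l u (MultiIndex.zero d l) = 1 := by
        intro u; simp [monomials, MultiIndex.zero]
      simp_rw [h2, mul_one] at h1
      simp only [Nat.factorial_zero, Nat.cast_one, inv_one, one_mul, iteratedFDerivWithin_zero_apply]
      rw [← Finset.sum_mul, h1, one_mul]
    · intro k hk
      have h1 := sum_interpolationWeight_mul_multilinear hh.ne' hB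
        (Nat.succ_le_of_lt (Finset.mem_range.1 hk)) (Nat.succ_ne_zero k)
        (iteratedFDerivWithin ℝ (k + 1) g (cube d) x)
      calc _ = (((k + 1).factorial : ℝ))⁻¹ * ∑ y ∈ grid d m, interpolationWeight l K m h y x *
            iteratedFDerivWithin ℝ (k + 1) g (cube d) x (fun _ => y - x) := by
            rw [Finset.mul_sum]
            exact Finset.sum_congr rfl fun y _ => by ring
        _ = 0 := by rw [h1, mul_zero]
  have hsub : ∑ y ∈ grid d m, g y * interpolationWeight l K m h y x - g x =
      ∑ y ∈ grid d m, interpolationWeight l K m h y x * (g y - P y) := by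
    simp_rw [mul_sub, Finset.sum_sub_distrib]
    rw [hrep]
    simp_rw [mul_comm]
  rw [hsub, Finset.sum_mul]
  refine (Finset.abs_sum_le_sum_abs _ _).trans (Finset.sum_le_sum fun y hy => ?_)
  rw [abs_mul]
  -- Only grid points in the kernel window count, and there the ℓ¹-distance to x is at most dh.
  by_cases hw : interpolationWeight l K m h y x = 0
  · simp [hw]
  have hk : kernelWeight K h x y ≠ 0 := fun h0 => hw (by simp [interpolationWeight, h0])
  refine mul_le_mul_of_nonneg_left ?_ (abs_nonneg _)
  have h1 := abs_sub_taylor_le hg hL hη hx (grid_subset_cube hy)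
  rw [hl] at h1
  refine h1.trans ?_
  gcongr
  calc _ ≤ ∑ _i : Fin d, h :=
        Finset.sum_le_sum fun i _ => abs_sub_le_of_kernelWeight_ne_zero hK hh hk i
    _ = d * h := by simp

end InterpolationError

/-! ### Estimates of the constants. -/

section Constants

variable {d l : ℕ}

theorem Lam_pos (hd : 0 < d) (hl : 0 < l) : 0 < Lam d l := by
  have hd' : (0 : ℝ) < d := by exact_mod_cast hd
  have hl' : (0 : ℝ) < l := by exact_mod_cast hl
  have h1 : (1 : ℝ) < ((l + d) / d) ^ d := by
    refine one_lt_pow₀ ?_ hd.ne'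
    rw [one_lt_div hd']; linarith
  have h2 : 0 < (((l : ℝ) + d) / d) ^ d - 1 := by linarith
  have h3 := Real.pi_pos
  unfold Lam
  positivity

/-- With N = l + d and D = (N/d)^d, the first two factors are together at most N^(dD) ≤ N^(lD), and
the last is at most N^(−6lD) since e^d ≥ 2. Finally D ≥ 1. -/
theorem Lam_le (hd : 0 < d) (hdl : d ≤ l) : Lam d l ≤ (((l : ℝ) + d) ^ (5 * l))⁻¹ := by
  have hd' : (1 : ℝ) ≤ d := by exact_mod_cast hd
  have hd0 : (0 : ℝ) < d := by linarith
  have hl' : (d : ℝ) ≤ l := by exact_mod_cast hdl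
  have hπ := Real.pi_pos
  unfold Lam
  set N : ℝ := (l : ℝ) + d with hN
  have hN1 : 1 ≤ N := by linarith
  have hN0 : 0 < N := by linarith
  set D : ℝ := (N / d) ^ d with hD
  have hD1 : 1 ≤ D := one_le_pow₀ (by rw [one_le_div hd0]; linarith)
  have he : 2 ≤ Real.exp 1 := by linarith [Real.add_one_le_exp (1 : ℝ)]
  have hA : (Real.pi * d / (8 * Real.exp 1 ^ 2)) ^ ((d : ℝ) * D) ≤ (d : ℝ) ^ ((d : ℝ) * D) := by
    refine Real.rpow_le_rpow (by positivity) ?_ (by positivity)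
    rw [div_le_iff₀ (by positivity)]
    rw [mul_comm]
    gcongr
    nlinarith [Real.pi_le_four]
  have hB : (D - 1) ^ (D - 1) ≤ (N / d) ^ ((d : ℝ) * D) := by
    calc (D - 1) ^ (D - 1) ≤ D ^ (D - 1) :=
          Real.rpow_le_rpow (by linarith) (by linarith) (by linarith)
      _ ≤ D ^ D := Real.rpow_le_rpow_of_exponent_le hD1 (by linarith)
      _ = (N / d) ^ ((d : ℝ) * D) := by
          rw [Real.rpow_mul (by positivity), Real.rpow_natCast]
  have hC : N ^ (6 * (l : ℝ) * D) ≤ N ^ (3 * (l : ℝ) * (Real.exp 1 * N / d) ^ d) := by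
    refine Real.rpow_le_rpow_of_exponent_le hN1 ?_
    rw [mul_div_assoc, mul_pow, ← hD]
    have h1 : 2 ≤ Real.exp 1 ^ d :=
      he.trans (le_self_pow₀ (by linarith) hd.ne')
    have h2 : (0 : ℝ) ≤ l * D := by positivity
    nlinarith
  have hAB : (d : ℝ) ^ ((d : ℝ) * D) * (N / d) ^ ((d : ℝ) * D) ≤ N ^ ((l : ℝ) * D) := by
    rw [← Real.mul_rpow hd0.le (by positivity), mul_div_cancel₀ _ hd0.ne']
    exact Real.rpow_le_rpow_of_exponent_le hN1 (by gcongr)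
  calc _ ≤ (d : ℝ) ^ ((d : ℝ) * D) * (N / d) ^ ((d : ℝ) * D) * (1 / N ^ (6 * (l : ℝ) * D)) := by
        have : 0 ≤ D - 1 := by linarith
        gcongr
    _ ≤ N ^ ((l : ℝ) * D) * (1 / N ^ (6 * (l : ℝ) * D)) := by gcongr
    _ = (N ^ (5 * (l : ℝ) * D))⁻¹ := by
        rw [mul_one_div, ← Real.rpow_sub hN0, ← Real.rpow_neg hN0.le]
        congr 1; ring
    _ ≤ (N ^ (5 * l))⁻¹ := by
        rw [← Real.rpow_natCast N (5 * l)]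
        push_cast
        refine inv_anti₀ (by positivity) (Real.rpow_le_rpow_of_exponent_le hN1 ?_)
        nlinarith [Nat.cast_nonneg (α := ℝ) l]

/-- Everything besides Λ is at most N^(3l+5) ≤ N^(5l), where N = l + d. -/
theorem Lam_mul_le_one (hd : 19 ≤ d) (hdl : d ≤ l) :
    (2 * (4 * (l : ℝ) * (3 * Real.exp 1) ^ d / Lam d l) + 1) * ((l : ℝ) + 1) ^ (2 * l + 1) *
      (l * Lam d l) ^ 2 ≤ 1 := by
  have hd' : (19 : ℝ) ≤ d := by exact_mod_cast hd
  have hl' : (d : ℝ) ≤ l := by exact_mod_cast hdl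
  have hΛ := Lam_pos (d := d) (l := l) (by omega) (by omega)
  have hΛ' := Lam_le (d := d) (l := l) (by omega) hdl
  set Λ := Lam d l
  set N : ℝ := (l : ℝ) + d with hN
  have hN1 : 1 ≤ N := by linarith
  have he : Real.exp 1 ≤ 3 := by linarith [Real.exp_one_lt_d9]
  have he' : 1 ≤ Real.exp 1 := by linarith [Real.add_one_le_exp (1 : ℝ)]
  have hpow : (3 * Real.exp 1) ^ d ≤ N ^ l := by
    calc _ ≤ (3 * Real.exp 1) ^ l := pow_le_pow_right₀ (by linarith) hdl
      _ ≤ N ^ l := by gcongr; linarith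
  have hinv : 1 ≤ Λ⁻¹ := by
    refine (one_le_inv₀ hΛ).2 (hΛ'.trans (inv_le_one_of_one_le₀ (one_le_pow₀ hN1)))
  have hM : 2 * (4 * (l : ℝ) * (3 * Real.exp 1) ^ d / Λ) + 1 ≤ N * N * N ^ l / Λ := by
    have h1 : (1 : ℝ) ≤ N * N ^ l / Λ := by
      rw [div_eq_mul_inv]
      have := one_le_pow₀ hN1 (n := l)
      nlinarith [mul_le_mul hN1 this zero_le_one (by linarith)]
    have h2 : 4 * (l : ℝ) * (3 * Real.exp 1) ^ d / Λ ≤ 4 * (N * N ^ l / Λ) := by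
      calc _ ≤ 4 * N * N ^ l / Λ := by gcongr; linarith
        _ = _ := by ring
    have h3 : N * N * N ^ l / Λ = N * (N * N ^ l / Λ) := by ring
    rw [h3]
    nlinarith
  have hQ : ((l : ℝ) + 1) ^ (2 * l + 1) ≤ N ^ (2 * l + 1) := by gcongr; linarith
  have hlN : (l : ℝ) ≤ N := by linarith
  calc _ ≤ N * N * N ^ l / Λ * N ^ (2 * l + 1) * (N * Λ) ^ 2 := by gcongr
    _ = N ^ (3 * l + 5) * Λ := by
        field_simp
        ring
    _ ≤ N ^ (5 * l) * (N ^ (5 * l))⁻¹ := by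
        exact mul_le_mul (pow_le_pow_right₀ hN1 (by omega)) hΛ' hΛ.le (by positivity)
    _ = 1 := mul_inv_cancel₀ (by positivity)

theorem sum_abs_mul_holder_le_one {S b c L η δ Λ M Q h : ℝ} (hd : 1 ≤ d) (hdl : d ≤ l)
    (hlη : l ≤ η) (hS0 : 0 ≤ S) (hb : 0 < b) (hbc : b ≤ c) (hL : 0 < L) (hδ : 0 < δ) (hΛ : 0 < Λ)
    (hM : 0 ≤ M) (hQ : 1 ≤ Q) (hh : 0 ≤ h) (hS : S ^ 2 ≤ (c * (2 * M + 1)) ^ d / b ^ d * Q ^ d)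
    (hΛM : (2 * M + 1) * Q * (l * Λ) ^ 2 ≤ 1)
    (hdh : d * h ≤ b / c * (l * Λ) / (2 * L + 1) * δ ^ (1 / η)) :
    S * (L * (d * h) ^ η) ≤ δ := by
  have hc : 0 < c := hb.trans_le hbc
  have hl1 : (1 : ℝ) ≤ l := by exact_mod_cast hd.trans hdl
  have hη : 0 < η := by linarith
  set q := b / c * (l * Λ) / (2 * L + 1) with hq
  have hlΛ0 : 0 < l * Λ := by positivity
  have hq0 : 0 < q := by positivity
  have hlΛ : l * Λ ≤ 1 := by
    have h1 : (l * Λ) ^ 2 ≤ (2 * M + 1) * Q * (l * Λ) ^ 2 :=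
      le_mul_of_one_le_left (sq_nonneg _) (by nlinarith)
    nlinarith
  have hbc1 : b / c ≤ 1 := (div_le_one hc).2 hbc
  have hq1 : q ≤ 1 := by
    rw [hq, div_le_one (by positivity)]
    nlinarith [mul_le_mul hbc1 hlΛ hlΛ0.le zero_le_one]
  have h1 : (d * h) ^ η ≤ q ^ l * δ := by
    calc (d * h) ^ η ≤ (q * δ ^ (1 / η)) ^ η := Real.rpow_le_rpow (by positivity) hdh hη.le
      _ = q ^ η * δ := by
          rw [Real.mul_rpow hq0.le (by positivity), ← Real.rpow_mul hδ.le, one_div_mul_cancel hη.ne',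
            Real.rpow_one]
      -- Since q ≤ 1 and l ≤ η, the exponent may be lowered to the integer l.
      _ ≤ q ^ (l : ℝ) * δ := by
          gcongr ?_ * δ
          exact Real.rpow_le_rpow_of_exponent_ge hq0 hq1 hlη
      _ = q ^ l * δ := by rw [Real.rpow_natCast]
  have h2 : L * q ^ l ≤ (b / c * (l * Λ)) ^ l := by
    rw [hq, div_pow, mul_div_assoc', div_le_iff₀ (by positivity), mul_comm]
    gcongr
    calc L ≤ 2 * L + 1 := by linarith
      _ ≤ _ := le_self_pow₀ (by linarith) (by omega)
  have h3 : S * (b / c * (l * Λ)) ^ l ≤ 1 := by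
    refine (sq_le_one_iff₀ (by positivity)).1 ?_
    have hbase : 1 ≤ c / b * (2 * M + 1) * Q := by
      have : 1 ≤ c / b := (one_le_div hb).2 hbc
      exact one_le_mul_of_one_le_of_one_le (one_le_mul_of_one_le_of_one_le this (by linarith)) hQ
    -- The bound on S² has exponent d but a base at least 1, so d ≤ l allows everything to be
    -- collected under one l-th power.
    calc (S * (b / c * (l * Λ)) ^ l) ^ 2 = S ^ 2 * ((b / c * (l * Λ)) ^ 2) ^ l := by ring
      _ ≤ (c / b * (2 * M + 1) * Q) ^ l * ((b / c * (l * Λ)) ^ 2) ^ l := by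
          gcongr
          calc S ^ 2 ≤ _ := hS
            _ = (c / b * (2 * M + 1) * Q) ^ d := by
              rw [← div_pow, ← mul_pow]; congr 1; ring
            _ ≤ _ := pow_le_pow_right₀ hbase hdl
      _ = (b / c * ((2 * M + 1) * Q * (l * Λ) ^ 2)) ^ l := by
          rw [← mul_pow]; congr 1; field_simp
      _ ≤ 1 := pow_le_one₀ (by positivity) (mul_le_one₀ hbc1 (by positivity) hΛM)
  calc S * (L * (d * h) ^ η) ≤ S * (L * (q ^ l * δ)) := by gcongr
    _ = S * (L * q ^ l) * δ := by ring
    _ ≤ S * (b / c * (l * Λ)) ^ l * δ := by gcongr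
    _ ≤ 1 * δ := by gcongr
    _ = δ := one_mul δ

theorem iteration_count_bounds {s X : ℝ} (hs : 1 < s) (hX : s ≤ X) {T : ℕ}
    (hT : T = ⌈(Real.log s)⁻¹ * Real.log X⌉₊) :
    X ≤ s ^ T ∧ s ^ T ≤ X * s ∧ (T : ℝ) ≤ 2 * Real.log X / Real.log s := by
  have hls := Real.log_pos hs
  have hs0 : 0 < s := by linarith
  have hX0 : 0 < X := by linarith
  have hlX : Real.log s ≤ Real.log X := Real.log_le_log hs0 hX
  have h1 : (Real.log s)⁻¹ * Real.log X ≤ T := by rw [hT]; exact Nat.le_ceil _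
  have h2 : (T : ℝ) < (Real.log s)⁻¹ * Real.log X + 1 := by
    rw [hT]; exact Nat.ceil_lt_add_one (mul_nonneg (inv_pos.2 hls).le (by linarith))
  rw [inv_mul_eq_div] at h1 h2
  have h3 : 1 ≤ Real.log X / Real.log s := (one_le_div hls).2 hlX
  have h4 : s ^ (Real.log X / Real.log s) = X := by
    rw [Real.rpow_def_of_pos hs0, mul_div_cancel₀ _ hls.ne', Real.exp_log hX0]
  refine ⟨?_, ?_, ?_⟩
  · rw [← Real.rpow_natCast]
    conv_lhs => rw [← h4]
    exact Real.rpow_le_rpow_of_exponent_le hs.le h1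
  · rw [← Real.rpow_natCast]
    calc s ^ (T : ℝ) ≤ s ^ (Real.log X / Real.log s + 1) :=
          Real.rpow_le_rpow_of_exponent_le hs.le h2.le
      _ = X * s := by rw [Real.rpow_add hs0, h4, Real.rpow_one]
  · rw [mul_div_assoc]; linarith

theorem calls_le_complexityBound {p T m : ℕ} {μ L₁ L₂ b c η ε gap δ : ℝ} (hd : 19 ≤ d)
    (hdl : d ≤ l) (hlη : l ≤ η) (hμ : 0 < μ) (hμL : μ < L₁) (hL₂ : 0 < L₂) (hb : 0 < b)
    (hbc : b ≤ c) (hε : 0 < ε)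
    (hX : L₁ / μ / (L₁ / μ - 1) ≤ (gap + p / (2 * μ)) / ε)
    (hT : T = ⌈(Real.log (L₁ / μ / (L₁ / μ - 1)))⁻¹ * Real.log ((gap + p / (2 * μ)) / ε)⌉₊)
    (hδ : δ = (1 - 1 / (L₁ / μ)) ^ ((T : ℝ) / 2))
    (hm : m = ⌈110 * (2 * L₂ + 1) * c / b *
      ((d : ℝ) * (3 * Real.exp 1) ^ d / Lam d l ^ 2) * (1 / δ) ^ (1 / η)⌉₊) :
    (T : ℝ) * (m : ℝ) ^ d ≤ complexityBound μ L₁ L₂ b c η ε gap d l p := by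
  have hL₁ : 0 < L₁ := hμ.trans hμL
  have hc : 0 < c := hb.trans_le hbc
  have hsub : 0 < L₁ - μ := by linarith
  have hd' : (19 : ℝ) ≤ d := by exact_mod_cast hd
  have hl' : (d : ℝ) ≤ l := by exact_mod_cast hdl
  have hη : 0 < η := by linarith
  set s := L₁ / μ / (L₁ / μ - 1) with hs
  have hs' : s = L₁ / (L₁ - μ) := by rw [hs]; field_simp
  have hs1 : 1 < s := by rw [hs', one_lt_div hsub]; linarith
  have hs0 : 0 < s := by linarith
  set X := (gap + p / (2 * μ)) / ε with hXdef
  obtain ⟨-, hTX, hT2⟩ := iteration_count_bounds hs1 hX hT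
  have hX0 : 0 < X := by linarith
  have hlX : 0 < Real.log X := Real.log_pos (by linarith)
  have hls := Real.log_pos hs1
  have hδs : 1 / δ = s ^ ((T : ℝ) / 2) := by
    have h1 : 1 - 1 / (L₁ / μ) = s⁻¹ := by rw [hs']; field_simp
    rw [hδ, h1, Real.inv_rpow hs0.le, one_div, inv_inv]
  set z := (1 / δ) ^ (1 / η) with hz
  have hz' : z = (s ^ T) ^ (1 / (2 * η)) := by
    rw [hz, hδs, ← Real.rpow_natCast s T, ← Real.rpow_mul hs0.le, ← Real.rpow_mul hs0.le]
    congr 1; field_simp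
  have hz1 : 1 ≤ z := by
    rw [hz']; exact Real.one_le_rpow (one_le_pow₀ hs1.le) (by positivity)
  set α : ℝ := d / (2 * η) with hα
  have hzd : z ^ d ≤ (X * s) ^ α := by
    rw [hz', ← Real.rpow_natCast _ d, ← Real.rpow_mul (by positivity), hα,
      one_div_mul_eq_div]
    exact Real.rpow_le_rpow (by positivity) hTX (by positivity)
  have hΛ := Lam_pos (d := d) (l := l) (by omega) (by omega)
  have hΛ' : Lam d l ≤ 1 := (Lam_le (d := d) (l := l) (by omega) hdl).trans
    (inv_le_one_of_one_le₀ (one_le_pow₀ (by linarith)))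
  set A : ℝ := 110 * (2 * L₂ + 1) * c / b * ((d : ℝ) * (3 * Real.exp 1) ^ d / Lam d l ^ 2) with hA
  have hA1 : 1 ≤ A := by
    have h1 : 1 ≤ 110 * (2 * L₂ + 1) * c / b := by
      rw [one_le_div hb]; nlinarith [mul_pos hL₂ hc]
    have h2 : 1 ≤ (d : ℝ) * (3 * Real.exp 1) ^ d / Lam d l ^ 2 := by
      rw [one_le_div (by positivity)]
      have h3 : 1 ≤ (3 * Real.exp 1) ^ d :=
        one_le_pow₀ (by linarith [Real.add_one_le_exp (1 : ℝ)])
      have h4 : Lam d l ^ 2 ≤ 1 := pow_le_one₀ hΛ.le hΛ'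
      nlinarith
    exact one_le_mul_of_one_le_of_one_le h1 h2
  -- A z ≥ 1 absorbs the ceiling, turning 110 into 220.
  have hm2 : (m : ℝ) ≤ 2 * A * z := by
    have h1 : (m : ℝ) < A * z + 1 := by
      rw [hm]; exact Nat.ceil_lt_add_one (by positivity)
    nlinarith [one_le_mul_of_one_le_of_one_le hA1 hz1]
  set Y := ((p : ℝ) + 2 * μ * gap) / ε with hY
  have hXY : X = Y / (2 * μ) := by rw [hXdef, hY]; field_simp; ring
  have hY0 : 0 < Y := by
    have : Y = X * (2 * μ) := by rw [hXY]; field_simp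
    rw [this]; positivity
  -- The extra s comes from rounding T up. As α ≤ 1, its contribution is at most 1 + s/(2μ), which
  -- gives the prefactor of the constant.
  have hpow : (X * s) ^ α ≤ Y ^ α * (1 + s / (2 * μ)) := by
    have h1 : X * s = Y * (s / (2 * μ)) := by rw [hXY]; ring
    rw [h1, Real.mul_rpow hY0.le (by positivity)]
    gcongr
    have hα0 : 0 ≤ α := by positivity
    have hα1 : α ≤ 1 := by rw [hα, div_le_one (by positivity)]; linarith
    have h2 : 0 < s / (2 * μ) := by positivity
    calc (s / (2 * μ)) ^ α ≤ (1 + s / (2 * μ)) ^ α :=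
          Real.rpow_le_rpow h2.le (by linarith) hα0
      _ ≤ (1 + s / (2 * μ)) ^ (1 : ℝ) := Real.rpow_le_rpow_of_exponent_le (by linarith) hα1
      _ = _ := Real.rpow_one _
  have hlogarg : ((p : ℝ) + 2 * μ * gap) / (2 * μ * ε) = X := by rw [hXdef]; field_simp; ring
  have hconst : complexityConst μ L₁ L₂ b c d l = (2 + s / μ) / Real.log s * (2 * A) ^ d := by
    rw [complexityConst, ← hs]
    have h1 : (L₁ / μ + 2 * (L₁ - μ)) / ((L₁ - μ) * Real.log s) = (2 + s / μ) / Real.log s := by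
      have : 2 + s / μ = (L₁ / μ + 2 * (L₁ - μ)) / (L₁ - μ) := by
        rw [hs']; field_simp; ring
      rw [this, div_div]
    have h2 : (2 * A) ^ d = (220 * (2 * L₂ + 1) * c / b) ^ d *
        ((d : ℝ) ^ d * (3 * Real.exp 1) ^ (d ^ 2) / Lam d l ^ (2 * d)) := by
      rw [pow_mul, sq d, pow_mul, ← mul_pow, ← div_pow, ← mul_pow, hA]
      congr 1; ring
    rw [h1, h2, mul_assoc]
  rw [complexityBound, hconst, hlogarg]
  calc (T : ℝ) * (m : ℝ) ^ d ≤ 2 * Real.log X / Real.log s * (2 * A * z) ^ d := by gcongr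
    _ = 2 * Real.log X / Real.log s * (2 * A) ^ d * z ^ d := by rw [mul_pow]; ring
    _ ≤ 2 * Real.log X / Real.log s * (2 * A) ^ d * (Y ^ α * (1 + s / (2 * μ))) := by
        gcongr
        exact hzd.trans hpow
    _ = _ := by rw [hα, hY]; field_simp

end Constants

/-- Dropping the ceiling in m only increases h, and then 4/110 = 2/55 is the constant in `margin`.
-/
theorem bandwidth_le_margin_mul {d l m : ℕ} {L₂ b c h w z : ℝ} (hd : 0 < d) (hl : 0 < l)
    (hL₂ : 0 < L₂) (hb : 0 < b) (hc : 0 < c) (hw : 0 < w) (hz : z = 1 / w)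
    (hm : m = ⌈110 * (2 * L₂ + 1) * c / b *
      ((d : ℝ) * (3 * Real.exp 1) ^ d / Lam d l ^ 2) * z⌉₊)
    (hh : h = 4 * (l : ℝ) * (3 * Real.exp 1) ^ d / (m * Lam d l)) :
    0 < m ∧ h ≤ margin d l L₂ b c * w := by
  have hΛ := Lam_pos hd hl
  have hd' : (0 : ℝ) < d := by exact_mod_cast hd
  have hl' : (0 : ℝ) < l := by exact_mod_cast hl
  have he := Real.exp_pos 1
  have hA : 0 < 110 * (2 * L₂ + 1) * c / b *
      ((d : ℝ) * (3 * Real.exp 1) ^ d / Lam d l ^ 2) * z := by rw [hz]; positivity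
  refine ⟨by rw [hm]; exact Nat.ceil_pos.2 hA, ?_⟩
  have hmA := Nat.le_ceil (110 * (2 * L₂ + 1) * c / b *
      ((d : ℝ) * (3 * Real.exp 1) ^ d / Lam d l ^ 2) * z)
  rw [← hm] at hmA
  rw [hh]
  calc _ ≤ 4 * (l : ℝ) * (3 * Real.exp 1) ^ d / ((110 * (2 * L₂ + 1) * c / b *
      ((d : ℝ) * (3 * Real.exp 1) ^ d / Lam d l ^ 2) * z) * Lam d l) := by gcongr
    _ = _ := by
      rw [margin, hz]
      field_simp
      norm_num

end LPIGD

/-! ### Assembly. -/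

open LPIGD
theorem theorem2 {n d p l : ℕ} (hn : 1 ≤ n) (hd : 19 ≤ d) (hdl : d ≤ l)
    {η L₁ L₂ μ b c : ℝ} (hl : (l : ℤ) = ⌈η⌉ - 1)
    (f : (Fin d → ℝ) → EuclideanSpace ℝ (Fin p) → ℝ) (hf : LossAssumptions f L₁ η L₂ μ)
    (K : ℝ → ℝ) (hK : IsKernel K b c)
    (x : Fin n → Fin d → ℝ)
    (hx : ∀ i j, x i j ∈ Set.Icc (margin d l L₂ b c) (1 - margin d l L₂ b c))
    (θ₀ : EuclideanSpace ℝ (Fin p))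
    {ε : ℝ} (hε_pos : 0 < ε) (hε_le : ε ≤ (L₁ - μ) * p / (2 * L₁ * μ))
    -- condition number, number of iterations, interpolation error, grid size, bandwidth
    (σ : ℝ) (hσ : σ = L₁ / μ)
    (T : ℕ) (hT : T = ⌈(Real.log (σ / (σ - 1)))⁻¹ *
      Real.log ((risk f x θ₀ - minRisk f x + p / (2 * μ)) / ε)⌉₊)
    (δ : ℝ) (hδ : δ = (1 - 1 / σ) ^ ((T : ℝ) / 2))
    (m : ℕ) (hm : m = ⌈110 * (2 * L₂ + 1) * c / b *
      ((d : ℝ) * (3 * Real.exp 1) ^ d / Lam d l ^ 2) * (1 / δ) ^ (1 / η)⌉₊)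
    (h : ℝ) (hh : h = 4 * (l : ℝ) * (3 * Real.exp 1) ^ d / (m * Lam d l)) :
    -- the returned vector is an `ε`-approximate solution
    IsApproxSolution f x ε ((lpiGD l K L₁ m h x T θ₀).output (oracle f)) ∧
    -- the whole run obeys the bound on the number of oracle calls
    ((lpiGD l K L₁ m h x T θ₀).calls (oracle f) : ℝ) ≤
      complexityBound μ L₁ L₂ b c η ε (risk f x θ₀ - minRisk f x) d l p ∧
    -- the first order oracle complexity is finite and obeys the bound
    ∃ Γ : ℕ,
      (lpiGD l K L₁ m h x T θ₀).oracleComplexity (oracle f) (IsApproxSolution f x ε) = (Γ : ℕ∞) ∧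
      (Γ : ℝ) ≤ complexityBound μ L₁ L₂ b c η ε (risk f x θ₀ - minRisk f x) d l p := by
  obtain ⟨hL₁, hη, hL₂, hμ⟩ : 0 < L₁ ∧ 0 < η ∧ 0 < L₂ ∧ 0 < μ :=
    ⟨hf.L₁_pos, hf.η_pos, hf.L₂_pos, hf.μ_pos⟩
  have hb := hK.b_pos
  have hbc := hK.b_le_c
  have hc : 0 < c := hb.trans_le hbc
  have hd' : (19 : ℝ) ≤ d := by exact_mod_cast hd
  have hl' : (d : ℝ) ≤ l := by exact_mod_cast hdl
  have hlη : (l : ℝ) < η := by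
    have : (l : ℤ) < ⌈η⌉ := by omega
    exact_mod_cast Int.lt_ceil.1 this
  have hceil : ⌈η⌉₊ - 1 = l := by
    rw [← Int.ceil_toNat]; omega
  -- Otherwise the upper bound on ε would be nonpositive.
  have hμL : μ < L₁ := by
    by_contra! hle
    have : (L₁ - μ) * p / (2 * L₁ * μ) ≤ 0 :=
      div_nonpos_of_nonpos_of_nonneg
        (mul_nonpos_of_nonpos_of_nonneg (by linarith) (Nat.cast_nonneg p)) (by positivity)
    linarith
  have hsub : 0 < L₁ - μ := by linarith
  subst hσ
  set s := L₁ / μ / (L₁ / μ - 1) with hs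
  have hs' : s = L₁ / (L₁ - μ) := by rw [hs]; field_simp
  have hs1 : 1 < s := by rw [hs', one_lt_div hsub]; linarith
  have hs0 : 0 < s := by linarith
  have hΛ := Lam_pos (d := d) (l := l) (by omega) (by omega)
  have hmargin : 0 < margin d l L₂ b c := by
    have : (0 : ℝ) < l := by linarith
    have : (0 : ℝ) < d := by linarith
    unfold margin; positivity
  have hxc : ∀ i, x i ∈ cube d := fun i =>
    ⟨fun j => hmargin.le.trans (hx i j).1, fun j => (hx i j).2.trans (by simpa using hmargin.le)⟩
  set gap := risk f x θ₀ - minRisk f x with hgap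
  have hgap0 : 0 ≤ gap := sub_nonneg.2 (minRisk_le hn hf hxc θ₀)
  -- The upper bound on ε says exactly sε ≤ p/(2μ); this ensures T ≤ 2 log X / log s for the
  -- right-hand side X.
  have hX : s ≤ (gap + p / (2 * μ)) / ε := by
    rw [le_div_iff₀ hε_pos]
    calc s * ε ≤ L₁ / (L₁ - μ) * ((L₁ - μ) * p / (2 * L₁ * μ)) := by rw [hs']; gcongr
      _ = p / (2 * μ) := by field_simp
      _ ≤ _ := by linarith
  have hr : 1 - μ / L₁ = s⁻¹ := by rw [hs']; field_simp
  have hδs : δ = s⁻¹ ^ ((T : ℝ) / 2) := by rw [hδ, one_div_div, hr]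
  have hsinv : 0 < s⁻¹ := inv_pos.2 hs0
  have hδ0 : 0 < δ := by rw [hδs]; positivity
  have hδ1 : δ ≤ 1 := by
    rw [hδs]; exact Real.rpow_le_one hsinv.le (inv_le_one_of_one_le₀ hs1.le) (by positivity)
  have hδsq : δ ^ 2 = s⁻¹ ^ T := by
    rw [hδs, ← Real.rpow_natCast, ← Real.rpow_mul hsinv.le, ← Real.rpow_natCast]
    congr 1; push_cast; ring
  set w := δ ^ (1 / η) with hw
  have hw0 : 0 < w := by positivity
  have hw1 : w ≤ 1 := Real.rpow_le_one hδ0.le hδ1 (by positivity)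
  obtain ⟨hm0, hhw⟩ := bandwidth_le_margin_mul (d := d) (l := l) (by omega) (by omega) hL₂ hb hc hw0
    (z := (1 / δ) ^ (1 / η)) (by rw [Real.div_rpow zero_le_one hδ0.le, Real.one_rpow]) hm hh
  have hm0' : (0 : ℝ) < m := by exact_mod_cast hm0
  set M : ℝ := 4 * (l : ℝ) * (3 * Real.exp 1) ^ d / Lam d l with hM
  have hmh : m * h = M := by rw [hh, hM]; field_simp
  -- Makes the window reach the l + 1 next grid points, while h ≤ `margin` keeps them inside the
  -- cube.
  have hMl : (l : ℝ) + 1 ≤ M := by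
    have h1 : 1 ≤ (3 * Real.exp 1) ^ d := one_le_pow₀ (by linarith [Real.add_one_le_exp (1 : ℝ)])
    have h2 : Lam d l ≤ 1 := (Lam_le (d := d) (l := l) (by omega) hdl).trans
      (inv_le_one_of_one_le₀ (one_le_pow₀ (by linarith)))
    rw [hM, le_div_iff₀ hΛ]
    nlinarith
  have hh0 : 0 < h := by
    have : h = M / m := by rw [← hmh]; field_simp
    rw [this]; exact div_pos (by linarith) hm0'
  have hlm : ((l : ℝ) + 1) / m ≤ h := by
    rw [div_le_iff₀ hm0', mul_comm, hmh]; exact hMl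
  have hhm : h ≤ margin d l L₂ b c := hhw.trans (mul_le_of_le_one_right hmargin.le hw1)
  have hdh : d * h ≤ b / c * (l * Lam d l) / (2 * L₂ + 1) * δ ^ (1 / η) := by
    have h1 : (0 : ℝ) < d := by linarith
    have h2 : (0 : ℝ) < l := by linarith
    calc d * h ≤ d * (margin d l L₂ b c * w) := by gcongr
      _ = 2 / 55 * (b / c * (l * Lam d l) / (2 * L₂ + 1) * δ ^ (1 / η)) := by
        rw [margin, ← hw]; field_simp
      _ ≤ _ := mul_le_of_le_one_left (by positivity) (by norm_num)
  have herr : ∀ (θ : EuclideanSpace ℝ (Fin p)) (i : Fin p) (j : Fin n),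
      |∑ y ∈ grid d m, gradient (f y) θ i * interpolationWeight l K m h y (x j) -
        gradient (f (x j)) θ i| ≤ δ := by
    intro θ i j
    have hx0 : ∀ k, 0 ≤ x j k := (hxc j).1
    have hN : ∀ k, (nextNodes l m (x j k)).card = l + 1 := fun k => card_nextNodes hm0 _
    have hgrid := piFinset_nextNodes_subset_grid (l := l) hm0 hx0 fun k => by
      linarith [(hx j k).2]
    have hwin : ∀ k, ∀ a ∈ nextNodes l m (x j k), |a - x j k| ≤ h := fun k a ha =>
      (abs_sub_le_of_mem_nextNodes hm0 (hx0 k) ha).trans hlm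
    have hB := isUnit_det_regressionMatrix hK hh0 hm0 hN hgrid hwin
    refine (abs_sum_mul_interpolationWeight_sub_le hK hh0 hB (hf.holder θ i) hL₂.le (by linarith)
      hceil (hxc j)).trans ?_
    refine sum_abs_mul_holder_le_one (M := M) (Q := ((l : ℝ) + 1) ^ (2 * l + 1)) (by omega) hdl
      hlη.le (Finset.sum_nonneg fun _ _ => abs_nonneg _) hb hbc hL₂ hδ0 hΛ (by linarith)
      (one_le_pow₀ (by linarith)) hh0.le ?_ (Lam_mul_le_one hd hdl) hdh
    refine (sq_sum_abs_interpolationWeight_le hK hh0 hm0 hN hgrid hwin).trans ?_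
    have hk := sum_kernelWeight_le (x := x j) hK hh0 hm0
    rw [hmh] at hk
    have := sum_sq_lagrangeWeight_le (l := l) hm0 hx0
    gcongr
  have hsol : IsApproxSolution f x ε ((lpiGD l K L₁ m h x T θ₀).output (oracle f)) := by
    refine (risk_output_lpiGD_le hn hf hxc hμL.le herr T θ₀).trans ?_
    obtain ⟨hXT, -, -⟩ := iteration_count_bounds hs1 hX hT
    rw [div_le_iff₀ hε_pos] at hXT
    have hinv : s⁻¹ ^ T ≤ 1 := pow_le_one₀ hsinv.le (inv_le_one_of_one_le₀ hs1.le)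
    have hinv0 : 0 < s⁻¹ ^ T := by positivity
    rw [hr, hδsq, ← hgap]
    calc _ ≤ s⁻¹ ^ T * gap + p * s⁻¹ ^ T / (2 * μ) * 1 := by gcongr; linarith
      _ = s⁻¹ ^ T * (gap + p / (2 * μ)) := by ring
      _ ≤ s⁻¹ ^ T * (s ^ T * ε) := by gcongr
      _ = ε := by rw [inv_pow, inv_mul_cancel_left₀ (by positivity)]
  have hcalls : ((lpiGD l K L₁ m h x T θ₀).calls (oracle f) : ℝ) ≤
      complexityBound μ L₁ L₂ b c η ε gap d l p := by
    rw [calls_lpiGD]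
    push_cast
    refine le_trans ?_ (calls_le_complexityBound hd hdl hlη.le hμ hμL hL₂ hb hbc hε_pos hX hT hδ hm)
    gcongr
    exact_mod_cast card_grid_le d m
  obtain ⟨Γ, hΓ, hΓle⟩ := OracleAlg.exists_oracleComplexity_eq (oracle f)
    (IsApproxSolution f x ε) _ hsol
  exact ⟨hsol, hcalls, Γ, hΓ, (Nat.cast_le.2 hΓle).trans hcalls⟩
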